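/- Let $n\ge 1$, let $\Omega\subset\mathbb R^n$ be a bounded open set, and let $(p_k)$ be a sequence in $(1,\infty)$ with $p_k\to\infty$. For each $k$ let $u_{k}\in W^{1,p_k}_0(\Omega)$ (the closure of $C_c^\infty(\Omega)$ in $W^{1,p_k}(\Omega)$) be a weak solution of $-\Delta_{p_k}u=1$ in $\Omega$, $u=0$ on $\partial\Omega$, that is, $\int_\Omega|\nabla u_k|^{p_k-2}\nabla u_k\cdot\nabla\eta\,dx=\int_\Omega\eta\,dx$ for all $\eta\in C_c^\infty(\Omega)$. Then there is a subsequence of $(u_k)$ whose members have representatives that are continuous on $\overline\Omega$ and vanish on $\partial\Omega$, and these representatives converge uniformly on $\overline\Omega$ to a function $u_\infty$ that is Hölder continuous on $\overline\Omega$ (with some exponent in $(0,1]$) and such that: 1. $u_\infty$ is a viscosity solution of $\min\{|\nabla u|-1,\,-\Delta_\infty u\}=0$ in $\Omega$, where $\Delta_\infty u=\sum_{i,j}u_{x_i}u_{x_ix_j}u_{x_j}$, and $u_\infty=0$ on $\partial\Omega$; 2. $u_\infty$ is a viscosity supersolution of $|\nabla u|-1=0$ in $\Omega$. Here, for a continuous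 $F$, an upper (resp. lower) semicontinuous function $u$ on $\Omega$ is a viscosity subsolution (resp. supersolution) of $F(\nabla u,D^2u)=0$ in $\Omega$ if, whenever $x\in\Omega$ and $v$ is of class $C^2$ near $x$ with $v(x)=u(x)$ and $v\ge u$ (resp. $v\le u$) near $x$, one has $F(\nabla v(x),D^2v(x))\le 0$ (resp. $\ge 0$); a viscosity solution is a function that is both. -/

import Mathlib

open MeasureTheory Filter Topology
open scoped ContDiff NNReal

namespace PTorsion

/-- The space `C_c^∞(Ω)` of smooth functions with compact support inside `Ω`. -/
def IsTestFunction {n : ℕ} (Ω : Set (EuclideanSpace ℝ (Fin n)))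
    (φ : EuclideanSpace ℝ (Fin n) → ℝ) : Prop :=
  ContDiff ℝ ∞ φ ∧ HasCompactSupport φ ∧ tsupport φ ⊆ Ω

/-- `G` is the weak (distributional) gradient of `u` in `Ω`. -/
def HasWeakGradient {n : ℕ} (Ω : Set (EuclideanSpace ℝ (Fin n)))
    (u : EuclideanSpace ℝ (Fin n) → ℝ)
    (G : EuclideanSpace ℝ (Fin n) → EuclideanSpace ℝ (Fin n)) : Prop :=
  LocallyIntegrableOn u Ω ∧ LocallyIntegrableOn G Ω ∧
    ∀ φ : EuclideanSpace ℝ (Fin n) → ℝ, IsTestFunction Ω φ →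
      ∫ x in Ω, u x • gradient φ x = - ∫ x in Ω, φ x • G x

/-- `u ∈ W^{1,p}(Ω)`, with weak gradient `G`. -/
def MemSobolev {n : ℕ} (p : ℝ) (Ω : Set (EuclideanSpace ℝ (Fin n)))
    (u : EuclideanSpace ℝ (Fin n) → ℝ)
    (G : EuclideanSpace ℝ (Fin n) → EuclideanSpace ℝ (Fin n)) : Prop :=
  MemLp u (ENNReal.ofReal p) (volume.restrict Ω) ∧
  MemLp G (ENNReal.ofReal p) (volume.restrict Ω) ∧
  HasWeakGradient Ω u G

/-- `u ∈ W^{1,p}_0(Ω)`, with weak gradient `G`: `u` lies in the closure of `C_c^∞(Ω)` with respect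
to the norm of `W^{1,p}(Ω)`. -/
def MemSobolevZero {n : ℕ} (p : ℝ) (Ω : Set (EuclideanSpace ℝ (Fin n)))
    (u : EuclideanSpace ℝ (Fin n) → ℝ)
    (G : EuclideanSpace ℝ (Fin n) → EuclideanSpace ℝ (Fin n)) : Prop :=
  MemSobolev p Ω u G ∧
  ∃ φ : ℕ → EuclideanSpace ℝ (Fin n) → ℝ,
    (∀ j, IsTestFunction Ω (φ j)) ∧
    Tendsto (fun j => eLpNorm (fun x => φ j x - u x) (ENNReal.ofReal p) (volume.restrict Ω))
      atTop (𝓝 0) ∧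
    Tendsto (fun j => eLpNorm (fun x => gradient (φ j) x - G x) (ENNReal.ofReal p)
      (volume.restrict Ω)) atTop (𝓝 0)

/-- `u` is a weak solution of `-Δ_p u = 1` in `Ω`, `u = 0` on `∂Ω`: it belongs to `W^{1,p}_0(Ω)`
and `∫_Ω |∇u|^{p-2} ∇u · ∇η dx = ∫_Ω η dx` for all `η ∈ C_c^∞(Ω)`. -/
def IsWeakSolution {n : ℕ} (p : ℝ) (Ω : Set (EuclideanSpace ℝ (Fin n)))
    (u : EuclideanSpace ℝ (Fin n) → ℝ) : Prop :=
  ∃ G : EuclideanSpace ℝ (Fin n) → EuclideanSpace ℝ (Fin n),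
    MemSobolevZero p Ω u G ∧
    ∀ η : EuclideanSpace ℝ (Fin n) → ℝ, IsTestFunction Ω η →
      ∫ x in Ω, ‖G x‖ ^ (p - 2) * inner ℝ (G x) (gradient η x) = ∫ x in Ω, η x

/-- The `C²` function `v` touches `u` from above in `x`. -/
def TouchesFromAbove {n : ℕ} (v u : EuclideanSpace ℝ (Fin n) → ℝ)
    (x : EuclideanSpace ℝ (Fin n)) : Prop :=
  ContDiffAt ℝ 2 v x ∧ v x = u x ∧ ∀ᶠ y in 𝓝 x, u y ≤ v y

/-- The `C²` function `w` touches `u` from below in `x`. -/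
def TouchesFromBelow {n : ℕ} (w u : EuclideanSpace ℝ (Fin n) → ℝ)
    (x : EuclideanSpace ℝ (Fin n)) : Prop :=
  ContDiffAt ℝ 2 w x ∧ w x = u x ∧ ∀ᶠ y in 𝓝 x, w y ≤ u y

/-- The Hessian `D²v(x)` as a bilinear form. -/
noncomputable def hessian {n : ℕ} (v : EuclideanSpace ℝ (Fin n) → ℝ)
    (x : EuclideanSpace ℝ (Fin n)) :
    EuclideanSpace ℝ (Fin n) →L[ℝ] EuclideanSpace ℝ (Fin n) →L[ℝ] ℝ :=
  fderiv ℝ (fderiv ℝ v) x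

/-- `u` is a viscosity subsolution of `F(∇u, D²u) = 0` in `Ω`. -/
def IsViscositySubsolution {n : ℕ}
    (F : EuclideanSpace ℝ (Fin n) →
      (EuclideanSpace ℝ (Fin n) →L[ℝ] EuclideanSpace ℝ (Fin n) →L[ℝ] ℝ) → ℝ)
    (Ω : Set (EuclideanSpace ℝ (Fin n))) (u : EuclideanSpace ℝ (Fin n) → ℝ) : Prop :=
  UpperSemicontinuousOn u Ω ∧
  ∀ x ∈ Ω, ∀ v : EuclideanSpace ℝ (Fin n) → ℝ, TouchesFromAbove v u x →
    F (gradient v x) (hessian v x) ≤ 0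

/-- `u` is a viscosity supersolution of `F(∇u, D²u) = 0` in `Ω`. -/
def IsViscositySupersolution {n : ℕ}
    (F : EuclideanSpace ℝ (Fin n) →
      (EuclideanSpace ℝ (Fin n) →L[ℝ] EuclideanSpace ℝ (Fin n) →L[ℝ] ℝ) → ℝ)
    (Ω : Set (EuclideanSpace ℝ (Fin n))) (u : EuclideanSpace ℝ (Fin n) → ℝ) : Prop :=
  LowerSemicontinuousOn u Ω ∧
  ∀ x ∈ Ω, ∀ w : EuclideanSpace ℝ (Fin n) → ℝ, TouchesFromBelow w u x →
    0 ≤ F (gradient w x) (hessian w x)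

/-- `u` is a viscosity solution of `F(∇u, D²u) = 0` in `Ω`. -/
def IsViscositySolution {n : ℕ}
    (F : EuclideanSpace ℝ (Fin n) →
      (EuclideanSpace ℝ (Fin n) →L[ℝ] EuclideanSpace ℝ (Fin n) →L[ℝ] ℝ) → ℝ)
    (Ω : Set (EuclideanSpace ℝ (Fin n))) (u : EuclideanSpace ℝ (Fin n) → ℝ) : Prop :=
  IsViscositySubsolution F Ω u ∧ IsViscositySupersolution F Ω u

/-- The operator `min{|∇u| - 1, -Δ_∞ u}` as a function of `ξ = ∇u` and `X = D²u`; here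
`Δ_∞ u = ∑ u_{x_i} u_{x_i x_j} u_{x_j} = D²u(∇u, ∇u)`. -/
noncomputable def limitOperator {n : ℕ} (ξ : EuclideanSpace ℝ (Fin n))
    (X : EuclideanSpace ℝ (Fin n) →L[ℝ] EuclideanSpace ℝ (Fin n) →L[ℝ] ℝ) : ℝ :=
  min (‖ξ‖ - 1) (-(X ξ ξ))

/-- The eikonal operator `|∇u| - 1` as a function of `ξ = ∇u` (and of `X = D²u`, which it does not
use). -/
noncomputable def eikonalOperator {n : ℕ} (ξ : EuclideanSpace ℝ (Fin n))
    (_X : EuclideanSpace ℝ (Fin n) →L[ℝ] EuclideanSpace ℝ (Fin n) →L[ℝ] ℝ) : ℝ :=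
  ‖ξ‖ - 1

end PTorsion

/-!
Comparing `φ(x)` with its average over the ball of radius `r` around `x` gives Morrey's inequality
with a modulus whose slope tends to `1` as `p → ∞` and whose constant term is then of order `r`.
A weak solution `u_p` may be tested against itself, so `‖∇u_p‖_p ^ p = ∫ u_p ≤ C ‖∇u_p‖_p`; hence
`‖∇u_p‖_p ≤ C ^ (1 / (p - 1)) → 1` and, up to `o(1)`, `u_p` is `1`-Lipschitz and lies below the
distance to `Ωᶜ`. Conversely, testing the equation against a smooth `η` with `|∇η| ≤ 1` that
approximates this distance, Young's inequality yields `∫ η ≤ ∫ u_p + |Ω| / p`. The distance to `Ωᶜ`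
is therefore the uniform limit of the whole family `u_p`. It is `1`-Lipschitz and decreases with
slope `1` along the segment from a point to a nearest point of `Ωᶜ`, which gives both viscosity
inequalities.
-/

namespace PTorsion

section InfDist

open Metric

lemma norm_le_comp_infDist {X F : Type*} [PseudoMetricSpace X] [SeminormedAddCommGroup F]
    {s : Set X} {v : X → F} {m : ℝ → ℝ} {x : X} (hs : s.Nonempty) (hv : ∀ y ∈ s, v y = 0)
    (hm : ContinuousAt m (infDist x s)) (hmod : ∀ y ∈ s, ‖v x - v y‖ ≤ m (dist x y)) :
    ‖v x‖ ≤ m (infDist x s) := by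
  obtain ⟨d, -, -, hd, hmem⟩ :=
    (isGLB_infDist hs).exists_seq_antitone_tendsto (hs.image (dist x))
  refine ge_of_tendsto' (hm.tendsto.comp hd) fun k => ?_
  obtain ⟨y, hy, hyd⟩ := hmem k
  simpa [hv y hy, hyd] using hmod y hy

lemma hasCompactSupport_infDist_compl {X : Type*} [PseudoMetricSpace X] [ProperSpace X]
    {Ω : Set X} (hΩ : Bornology.IsBounded Ω) : HasCompactSupport (infDist · Ωᶜ) :=
  .of_support_subset_isCompact hΩ.isCompact_closure fun _ hx =>
    subset_closure (not_imp_comm.1 (fun h => infDist_zero_of_mem (s := Ωᶜ) h) hx)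

lemma exists_infDist_compl_le {X : Type*} [PseudoMetricSpace X] [ProperSpace X] {Ω : Set X}
    (hΩ : Bornology.IsBounded Ω) : ∃ D, 0 ≤ D ∧ ∀ x, infDist x Ωᶜ ≤ D := by
  rcases isEmpty_or_nonempty X with _ | ⟨⟨x₀⟩⟩
  · exact ⟨0, le_rfl, isEmptyElim⟩
  obtain ⟨D, hD⟩ := (continuous_infDist_pt Ωᶜ).bounded_above_of_compact_support
    (hasCompactSupport_infDist_compl hΩ)
  exact ⟨D, (norm_nonneg _).trans (hD x₀), fun x => (Real.le_norm_self _).trans (hD x)⟩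

end InfDist

section Morrey

open Module Metric
open scoped Pointwise

lemma setAverage_norm_le_lpNorm {α F : Type*} [MeasurableSpace α] [NormedAddCommGroup F]
    {μ : Measure α} {s : Set α} {f : α → F} {p : ℝ} (hp : 1 ≤ p) (hs₀ : μ s ≠ 0)
    (hs : μ s ≠ ⊤) (hf : MemLp f (ENNReal.ofReal p) μ) :
    ⨍ x in s, ‖f x‖ ∂μ ≤ μ.real s ^ (-(1 / p)) * lpNorm f (ENNReal.ofReal p) μ := by
  have hfs := hf.aestronglyMeasurable.restrict (s := s)
  have hs' : 0 < μ.real s := ENNReal.toReal_pos hs₀ hs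
  have hHolder : eLpNorm f 1 (μ.restrict s) ≤
      eLpNorm f (ENNReal.ofReal p) μ * μ s ^ (1 - 1 / p) := by
    have h := eLpNorm_le_eLpNorm_mul_rpow_measure_univ (ENNReal.one_le_ofReal.2 hp) hfs
    rw [ENNReal.toReal_one, div_one, ENNReal.toReal_ofReal (by linarith),
      Measure.restrict_apply_univ] at h
    exact h.trans (by gcongr; exact Measure.restrict_le_self)
  have hint : ∫ x in s, ‖f x‖ ∂μ ≤ lpNorm f (ENNReal.ofReal p) μ * μ.real s ^ (1 - 1 / p) := by
    rw [← lpNorm_one_eq_integral_norm hfs, ← toReal_eLpNorm hfs,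
      ← toReal_eLpNorm hf.aestronglyMeasurable, measureReal_def, ENNReal.toReal_rpow,
      ← ENNReal.toReal_mul]
    refine ENNReal.toReal_mono (ENNReal.mul_ne_top hf.eLpNorm_ne_top ?_) hHolder
    exact ENNReal.rpow_ne_top_of_ne_zero hs₀ hs
  rw [setAverage_eq, smul_eq_mul]
  calc (μ.real s)⁻¹ * ∫ x in s, ‖f x‖ ∂μ
      ≤ (μ.real s)⁻¹ * (lpNorm f (ENNReal.ofReal p) μ * μ.real s ^ (1 - 1 / p)) := by gcongr
    _ = μ.real s ^ (-(1 / p)) * lpNorm f (ENNReal.ofReal p) μ := by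
      rw [sub_eq_add_neg, Real.rpow_add hs', Real.rpow_one]
      field_simp

lemma norm_apply_add_smul_le {E F : Type*} [NormedAddCommGroup E] [NormedSpace ℝ E]
    [NormedAddCommGroup F] [NormedSpace ℝ F] (L : E →L[ℝ] F) (e : E) {z : E}
    (hz : z ∈ ball (0 : E) 1) (s : ℝ) :
    ‖L (e + s • z)‖ ≤ (‖e‖ + |s|) * ‖L‖ := by
  rw [mul_comm]
  refine L.le_opNorm_of_le ((norm_add_le _ _).trans ?_)
  rw [norm_smul, Real.norm_eq_abs]
  gcongr
  exact mul_le_of_le_one_right (abs_nonneg s) (mem_ball_zero_iff.1 hz).le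

variable {E : Type*} [NormedAddCommGroup E] [NormedSpace ℝ E] [MeasurableSpace E] (μ : Measure E)

/-- The bound on `‖φ x - φ y‖` for `‖x - y‖ = s` and `‖∇φ‖_p = 1` that comes from comparing the
values of `φ` with its averages over balls of radius `r`. The free parameter `r` is what makes it
sharp: as `p → ∞` and then `r → 0` it tends to `s`. -/
noncomputable def morreyModulus (p r s : ℝ) : ℝ :=
  μ.real (ball (0 : E) r) ^ (-(1 / p)) * (2 * r / (1 - finrank ℝ E / p) + s)

lemma morreyModulus_nonneg {p r s : ℝ} (hp : 0 < p) (hpn : finrank ℝ E < p) (hr : 0 ≤ r)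
    (hs : 0 ≤ s) : 0 ≤ morreyModulus μ p r s := by
  have : 0 < 1 - finrank ℝ E / p := sub_pos.2 ((div_lt_one hp).2 hpn)
  unfold morreyModulus
  positivity

lemma morreyModulus_mono (p r : ℝ) : Monotone (morreyModulus μ p r) := by
  intro s t hst
  unfold morreyModulus
  gcongr

lemma norm_le_morreyModulus_infDist_mul {F : Type*} [SeminormedAddCommGroup F] {s : Set E}
    {v : E → F} {p r M : ℝ} (hs : s.Nonempty) (hv : ∀ y ∈ s, v y = 0)
    (hmod : ∀ x y, ‖v x - v y‖ ≤ morreyModulus μ p r ‖x - y‖ * M) (x : E) :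
    ‖v x‖ ≤ morreyModulus μ p r (infDist x s) * M := by
  refine norm_le_comp_infDist (m := fun s => morreyModulus μ p r s * M) hs hv ?_
    fun y _ => dist_eq_norm x y ▸ hmod x y
  unfold morreyModulus
  fun_prop

lemma eventually_morreyModulus_mul_le [FiniteDimensional ℝ E] [μ.IsAddHaarMeasure]
    {ι : Type*} {l : Filter ι} {p c : ι → ℝ} (hp : Tendsto p l atTop)
    (hc : Tendsto c l (𝓝 1)) {ε : ℝ} (hε : 0 < ε) :
    ∃ r > 0, ∀ᶠ i in l, ∀ s, 0 ≤ s → morreyModulus μ (p i) r s * c i ≤ ε + (1 + ε) * s := by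
  have hr : 0 < ε / 4 := by positivity
  have hinv : Tendsto (fun i => -(1 / p i)) l (𝓝 0) := by
    simpa using hp.inv_tendsto_atTop.neg
  have hfactor : Tendsto (fun i => μ.real (ball (0 : E) (ε / 4)) ^ (-(1 / p i)) * c i) l (𝓝 1) := by
    have hV : μ.real (ball (0 : E) (ε / 4)) ≠ 0 :=
      (ENNReal.toReal_pos (measure_ball_pos μ _ hr).ne' measure_ball_lt_top.ne).ne'
    simpa using ((Real.continuousAt_const_rpow hV).tendsto.comp hinv).mul hc
  have hconst : Tendsto (fun i => μ.real (ball (0 : E) (ε / 4)) ^ (-(1 / p i)) * c i *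
      (2 * (ε / 4) / (1 - finrank ℝ E / p i))) l (𝓝 (2 * (ε / 4))) := by
    simpa using hfactor.mul
      (tendsto_const_nhds.div (tendsto_const_nhds.sub (hp.const_div_atTop _))
        (by simp : (1 : ℝ) - 0 ≠ 0))
  refine ⟨ε / 4, hr, ?_⟩
  filter_upwards [hfactor.eventually_le_const (by linarith : 1 < 1 + ε),
    hconst.eventually_le_const (by linarith : 2 * (ε / 4) < ε)] with i hi₁ hi₂ s hs
  rw [morreyModulus, mul_right_comm, mul_add]
  gcongr

variable [FiniteDimensional ℝ E] [BorelSpace E] [μ.IsAddHaarMeasure]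

lemma measureReal_ball_rpow_neg (p : ℝ) {t : ℝ} (ht : 0 < t) :
    μ.real (ball (0 : E) t) ^ (-(1 / p)) =
      t ^ (-(finrank ℝ E / p)) * μ.real (ball (0 : E) 1) ^ (-(1 / p)) := by
  rw [measureReal_def, Measure.addHaar_ball_of_pos μ _ ht, ENNReal.toReal_mul, ← measureReal_def,
    ENNReal.toReal_ofReal (by positivity), Real.mul_rpow (by positivity) measureReal_nonneg,
    ← Real.rpow_natCast, ← Real.rpow_mul ht.le]
  ring_nf

variable {F : Type*} [NormedAddCommGroup F]

lemma setAverage_unitBall_comp_add_smul [NormedSpace ℝ F] (f : E → F) (c : E) {r : ℝ} (hr : 0 < r) :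
    ⨍ z in ball (0 : E) 1, f (c + r • z) ∂μ = ⨍ x in ball c r, f x ∂μ := by
  have hball : r • ball (0 : E) 1 = (c + ·) ⁻¹' ball c r := by
    rw [preimage_add_ball, sub_self, smul_unitBall_of_pos hr]
  rw [setAverage_eq, setAverage_eq,
    Measure.setIntegral_comp_smul_of_pos μ (fun x => f (c + x)) _ hr, smul_smul, hball,
    (measurePreserving_add_left μ c).setIntegral_preimage_emb (measurableEmbedding_addLeft c),
    measureReal_def, measureReal_def, Measure.addHaar_ball_of_pos μ c hr, ENNReal.toReal_mul,
    ENNReal.toReal_ofReal (by positivity), mul_inv, mul_comm]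

lemma setAverage_unitBall_norm_le_lpNorm {f : E → F} {p : ℝ} (hp : 1 ≤ p)
    (hf : MemLp f (ENNReal.ofReal p) μ) (c : E) {r : ℝ} (hr : 0 < r) :
    ⨍ z in ball (0 : E) 1, ‖f (c + r • z)‖ ∂μ ≤
      μ.real (ball (0 : E) r) ^ (-(1 / p)) * lpNorm f (ENNReal.ofReal p) μ := by
  rw [setAverage_unitBall_comp_add_smul μ (fun x => ‖f x‖) c hr,
    ← Measure.addHaar_real_ball_center μ c r]
  exact setAverage_norm_le_lpNorm hp (measure_ball_pos μ c hr).ne' measure_ball_lt_top.ne hf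

variable [NormedSpace ℝ F] {φ : E → F}

lemma hasDerivAt_setAverage_unitBall (hφ : ContDiff ℝ 1 φ) (hφs : HasCompactSupport φ)
    (c e : E) (r s t : ℝ) :
    HasDerivAt (fun t : ℝ => ⨍ z in ball (0 : E) 1, φ (c + t • e + (r + t * s) • z) ∂μ)
      (⨍ z in ball (0 : E) 1, fderiv ℝ φ (c + t • e + (r + t * s) • z) (e + s • z) ∂μ) t := by
  simp only [setAverage_eq]
  have hφ' : Continuous (fderiv ℝ φ) := hφ.continuous_fderiv one_ne_zero
  obtain ⟨C, hC⟩ := hφ.continuous.bounded_above_of_compact_support hφs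
  obtain ⟨C', hC'⟩ := hφ'.bounded_above_of_compact_support (hφs.fderiv (𝕜 := ℝ))
  have : IsFiniteMeasure (μ.restrict (ball (0 : E) 1)) :=
    isFiniteMeasure_restrict.2 measure_ball_lt_top.ne
  have hcomp' : Continuous fun z : E => fderiv ℝ φ (c + t • e + (r + t * s) • z) (e + s • z) := by
    fun_prop
  have hcomp (t : ℝ) : Continuous fun z : E => φ (c + t • e + (r + t * s) • z) :=
    hφ.continuous.comp (by fun_prop)
  have hpath (z : E) (t : ℝ) :
      HasDerivAt (fun t : ℝ => c + t • e + (r + t * s) • z) (e + s • z) t :=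
    ((((hasDerivAt_id t).smul_const e).const_add c).add
      ((((hasDerivAt_id t).mul_const s).const_add r).smul_const z)).congr_deriv (by simp)
  refine HasDerivAt.const_smul _ (hasDerivAt_integral_of_dominated_loc_of_deriv_le
    (F := fun t z => φ (c + t • e + (r + t * s) • z))
    (F' := fun t z => fderiv ℝ φ (c + t • e + (r + t * s) • z) (e + s • z))
    (bound := fun _ => (‖e‖ + |s|) * C') univ_mem
    (Eventually.of_forall fun t => (hcomp t).aestronglyMeasurable)
    (Integrable.of_bound (hcomp t).aestronglyMeasurable C (Eventually.of_forall fun _ => hC _))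
    hcomp'.aestronglyMeasurable ?_ (integrable_const _) ?_).2
  · filter_upwards [ae_restrict_mem measurableSet_ball] with z hz t _
    exact (norm_apply_add_smul_le _ e hz s).trans (by gcongr; exact hC' _)
  · refine Eventually.of_forall fun z t _ => ?_
    exact (hφ.differentiable one_ne_zero _).hasFDerivAt.comp_hasDerivAt t (hpath z t)

lemma norm_setAverage_unitBall_fderiv_le (hφ : ContDiff ℝ 1 φ) (hφs : HasCompactSupport φ)
    {p : ℝ} (hp : 1 ≤ p) (c e : E) {r : ℝ} (hr : 0 < r) (s : ℝ) :
    ‖⨍ z in ball (0 : E) 1, fderiv ℝ φ (c + r • z) (e + s • z) ∂μ‖ ≤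
      (‖e‖ + |s|) * (μ.real (ball (0 : E) r) ^ (-(1 / p)) *
        lpNorm (fderiv ℝ φ) (ENNReal.ofReal p) μ) := by
  have hφ' : Continuous (fderiv ℝ φ) := hφ.continuous_fderiv one_ne_zero
  refine le_trans ?_ (mul_le_mul_of_nonneg_left (setAverage_unitBall_norm_le_lpNorm μ hp
    (hφ'.memLp_of_hasCompactSupport (hφs.fderiv (𝕜 := ℝ))) c hr) (by positivity))
  rw [setAverage_eq, setAverage_eq, norm_smul, Real.norm_of_nonneg (by positivity), smul_eq_mul,
    mul_left_comm, ← integral_const_mul]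
  gcongr
  refine norm_integral_le_of_norm_le ?_ ?_
  · have : Continuous fun z : E => (‖e‖ + |s|) * ‖fderiv ℝ φ (c + r • z)‖ := by fun_prop
    exact (this.continuousOn.integrableOn_compact (isCompact_closedBall 0 1)).mono_set
      ball_subset_closedBall
  · filter_upwards [ae_restrict_mem measurableSet_ball] with z hz
    exact norm_apply_add_smul_le _ e hz s

lemma norm_setAverage_unitBall_sub_setAverage_unitBall_le (hφ : ContDiff ℝ 1 φ)
    (hφs : HasCompactSupport φ) {p : ℝ} (hp : 1 ≤ p) (x y : E) {r : ℝ} (hr : 0 < r) :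
    ‖⨍ z in ball (0 : E) 1, φ (y + r • z) ∂μ - ⨍ z in ball (0 : E) 1, φ (x + r • z) ∂μ‖ ≤
      ‖y - x‖ * (μ.real (ball (0 : E) r) ^ (-(1 / p)) *
        lpNorm (fderiv ℝ φ) (ENNReal.ofReal p) μ) := by
  have hderiv := hasDerivAt_setAverage_unitBall μ hφ hφs x (y - x) r 0
  have hbound (t : ℝ) := norm_setAverage_unitBall_fderiv_le μ hφ hφs hp (x + t • (y - x)) (y - x)
    hr 0
  simp only [mul_zero, add_zero, abs_zero] at hderiv hbound
  simpa using convex_univ.norm_image_sub_le_of_norm_hasDerivWithin_le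
    (fun t _ => (hderiv t).hasDerivWithinAt) (fun t _ => hbound t)
    (Set.mem_univ (0 : ℝ)) (Set.mem_univ 1)

lemma norm_setAverage_unitBall_sub_apply_le [CompleteSpace F] (hφ : ContDiff ℝ 1 φ)
    (hφs : HasCompactSupport φ) {p : ℝ} (hp : 1 ≤ p) (hpn : finrank ℝ E < p) (x : E)
    {r : ℝ} (hr : 0 < r) :
    ‖⨍ z in ball (0 : E) 1, φ (x + r • z) ∂μ - φ x‖ ≤
      r / (1 - finrank ℝ E / p) * (μ.real (ball (0 : E) r) ^ (-(1 / p)) *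
        lpNorm (fderiv ℝ φ) (ENNReal.ofReal p) μ) := by
  set N := lpNorm (fderiv ℝ φ) (ENNReal.ofReal p) μ
  set a : ℝ := finrank ℝ E / p
  set V := μ.real (ball (0 : E) 1) ^ (-(1 / p))
  have ha : -1 < -a := neg_lt_neg ((div_lt_one (by linarith)).2 hpn)
  have hderiv (t : ℝ) : HasDerivAt (fun t : ℝ => ⨍ z in ball (0 : E) 1, φ (x + t • z) ∂μ)
      (⨍ z in ball (0 : E) 1, fderiv ℝ φ (x + t • z) z ∂μ) t := by
    simpa using hasDerivAt_setAverage_unitBall μ hφ hφs x 0 0 1 t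
  have hbound (t : ℝ) (ht : t ∈ Set.Ioo 0 r) :
      ‖deriv (fun t : ℝ => ⨍ z in ball (0 : E) 1, φ (x + t • z) ∂μ) t‖ ≤ t ^ (-a) * (V * N) := by
    have h := norm_setAverage_unitBall_fderiv_le μ hφ hφs hp x 0 ht.1 1
    rw [measureReal_ball_rpow_neg μ p ht.1] at h
    simpa only [(hderiv t).deriv, norm_zero, zero_add, abs_one, one_mul, one_smul, mul_assoc]
      using h
  have hzero : ⨍ z in ball (0 : E) 1, φ (x + (0 : ℝ) • z) ∂μ = φ x := by
    simp only [zero_smul, add_zero]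
    exact setAverage_const (measure_ball_pos μ _ one_pos).ne' measure_ball_lt_top.ne _
  calc ‖⨍ z in ball (0 : E) 1, φ (x + r • z) ∂μ - φ x‖
      ≤ ∫ t in (0 : ℝ)..r, t ^ (-a) * (V * N) := by
        rw [← hzero]
        exact norm_sub_le_integral_of_norm_deriv_le_of_le hr.le
          (fun t _ => (hderiv t).continuousAt.continuousWithinAt)
          (fun t _ => (hderiv t).differentiableAt.differentiableWithinAt)
          (Eventually.of_forall hbound) ((intervalIntegral.intervalIntegrable_rpow' ha).mul_const _)
    _ = r / (1 - a) * (r ^ (-a) * V * N) := by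
        rw [intervalIntegral.integral_mul_const, integral_rpow (Or.inl ha),
          Real.zero_rpow (by linarith), sub_zero, neg_add_eq_sub, sub_eq_add_neg,
          Real.rpow_add hr, Real.rpow_one]
        ring
    _ = r / (1 - a) * (μ.real (ball (0 : E) r) ^ (-(1 / p)) * N) := by
        rw [measureReal_ball_rpow_neg μ p hr]

theorem norm_sub_le_morreyModulus_mul [CompleteSpace F] (hφ : ContDiff ℝ 1 φ)
    (hφs : HasCompactSupport φ) {p : ℝ} (hp : 1 ≤ p) (hpn : finrank ℝ E < p) (x y : E)
    {r : ℝ} (hr : 0 < r) :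
    ‖φ x - φ y‖ ≤ morreyModulus μ p r ‖x - y‖ * lpNorm (fderiv ℝ φ) (ENNReal.ofReal p) μ := by
  set A : E → F := fun c => ⨍ z in ball (0 : E) 1, φ (c + r • z) ∂μ
  have hx := norm_setAverage_unitBall_sub_apply_le μ hφ hφs hp hpn x hr
  have hy := norm_setAverage_unitBall_sub_apply_le μ hφ hφs hp hpn y hr
  have hxy := norm_setAverage_unitBall_sub_setAverage_unitBall_le μ hφ hφs hp y x hr
  calc ‖φ x - φ y‖ = ‖(A x - A y) - (A x - φ x) + (A y - φ y)‖ := by congr 1; abel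
    _ ≤ ‖A x - A y‖ + ‖A x - φ x‖ + ‖A y - φ y‖ := norm_add_le_of_le (norm_sub_le _ _) le_rfl
    _ ≤ _ := add_le_add (add_le_add hxy hx) hy
    _ = _ := by rw [morreyModulus]; ring

end Morrey

section Convergence

lemma tendsto_lpNorm_of_tendsto_lpNorm_sub {α ι F : Type*} [MeasurableSpace α]
    [NormedAddCommGroup F] {μ : Measure α} {l : Filter ι} {f : ι → α → F} {g : α → F}
    {q : ENNReal} (hq : 1 ≤ q) (hf : ∀ i, MemLp (f i) q μ) (hg : MemLp g q μ)
    (hfg : Tendsto (fun i => lpNorm (f i - g) q μ) l (𝓝 0)) :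
    Tendsto (fun i => lpNorm (f i) q μ) l (𝓝 (lpNorm g q μ)) := by
  refine tendsto_iff_norm_sub_tendsto_zero.2
    (squeeze_zero (fun _ => norm_nonneg _) (fun i => abs_sub_le_iff.2 ⟨?_, ?_⟩) hfg)
  · exact sub_le_iff_le_add'.2 (lpNorm_le_lpNorm_add_lpNorm_sub' hg hq)
  · exact sub_le_iff_le_add'.2 (lpNorm_le_lpNorm_add_lpNorm_sub (hf i) hq)

lemma exists_tendstoUniformly_of_norm_sub_le {α F : Type*} [NormedAddCommGroup F]
    [CompleteSpace F] {f : ℕ → α → F} {b : ℕ → ℝ} (hb : Tendsto b atTop (𝓝 0))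
    (hf : ∀ i j x, ‖f i x - f j x‖ ≤ b i + b j) : ∃ g, TendstoUniformly f g atTop := by
  have hcauchy : UniformCauchySeqOn f atTop Set.univ := by
    refine Metric.uniformCauchySeqOn_iff.2 fun ε hε => ?_
    obtain ⟨N, hN⟩ := eventually_atTop.1 (hb.eventually_lt_const (half_pos hε))
    refine ⟨N, fun i hi j hj x _ => ?_⟩
    rw [dist_eq_norm]
    linarith [hf i j x, hN i hi, hN j hj]
  choose g hg using fun x => cauchySeq_tendsto_of_complete (hcauchy.cauchySeq (Set.mem_univ x))
  exact ⟨g, tendstoUniformlyOn_univ.1 (hcauchy.tendstoUniformlyOn_of_tendsto fun x _ => hg x)⟩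

lemma ae_eq_of_tendsto_eLpNorm_of_tendsto {α F : Type*} [MeasurableSpace α]
    [NormedAddCommGroup F] {μ : Measure α} {f : ℕ → α → F} {g h : α → F} {q : ENNReal}
    (hq : q ≠ 0) (hf : ∀ j, AEStronglyMeasurable (f j) μ) (hg : AEStronglyMeasurable g μ)
    (hfg : Tendsto (fun j => eLpNorm (f j - g) q μ) atTop (𝓝 0))
    (hfh : ∀ x, Tendsto (fun j => f j x) atTop (𝓝 (h x))) : h =ᵐ[μ] g := by
  obtain ⟨k, hk, hae⟩ := (tendstoInMeasure_of_tendsto_eLpNorm hq hf hg hfg).exists_seq_tendsto_ae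
  filter_upwards [hae] with x hx
  exact tendsto_nhds_unique ((hfh x).comp hk.tendsto_atTop) hx

end Convergence

section Sobolev

open Metric

variable {n : ℕ} {Ω : Set (EuclideanSpace ℝ (Fin n))} {φ ψ : EuclideanSpace ℝ (Fin n) → ℝ}

lemma norm_gradient (φ : EuclideanSpace ℝ (Fin n) → ℝ) (x : EuclideanSpace ℝ (Fin n)) :
    ‖gradient φ x‖ = ‖fderiv ℝ φ x‖ :=
  LinearIsometryEquiv.norm_map _ _

lemma IsTestFunction.contDiff_one (h : IsTestFunction Ω φ) : ContDiff ℝ 1 φ :=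
  h.1.of_le (by simp)

lemma IsTestFunction.eq_zero (h : IsTestFunction Ω φ) {x : EuclideanSpace ℝ (Fin n)}
    (hx : x ∉ Ω) : φ x = 0 :=
  image_eq_zero_of_notMem_tsupport fun hx' => hx (h.2.2 hx')

lemma IsTestFunction.fderiv_eq_zero (h : IsTestFunction Ω φ) {x : EuclideanSpace ℝ (Fin n)}
    (hx : x ∉ Ω) : fderiv ℝ φ x = 0 :=
  image_eq_zero_of_notMem_tsupport fun hx' => hx (h.2.2 (tsupport_fderiv_subset ℝ hx'))

lemma IsTestFunction.continuous_gradient (h : IsTestFunction Ω φ) : Continuous (gradient φ) :=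
  (LinearIsometryEquiv.continuous _).comp (h.contDiff_one.continuous_fderiv one_ne_zero)

lemma IsTestFunction.sub (hφ : IsTestFunction Ω φ) (hψ : IsTestFunction Ω ψ) :
    IsTestFunction Ω (φ - ψ) :=
  ⟨hφ.1.sub hψ.1, hφ.2.1.sub hψ.2.1,
    (tsupport_sub φ ψ).trans (Set.union_subset hφ.2.2 hψ.2.2)⟩

lemma IsTestFunction.gradient_sub (hφ : IsTestFunction Ω φ) (hψ : IsTestFunction Ω ψ) :
    gradient (φ - ψ) = gradient φ - gradient ψ := by
  ext1 x
  simp only [gradient, Pi.sub_apply]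
  rw [fderiv_sub (hφ.contDiff_one.differentiable one_ne_zero x)
    (hψ.contDiff_one.differentiable one_ne_zero x), map_sub]

lemma IsTestFunction.memLp (h : IsTestFunction Ω φ) (q : ENNReal)
    (μ : Measure (EuclideanSpace ℝ (Fin n))) [IsFiniteMeasureOnCompacts μ] : MemLp φ q μ :=
  h.1.continuous.memLp_of_hasCompactSupport h.2.1

lemma IsTestFunction.memLp_gradient (h : IsTestFunction Ω φ) (q : ENNReal)
    (μ : Measure (EuclideanSpace ℝ (Fin n))) [IsFiniteMeasureOnCompacts μ] :
    MemLp (gradient φ) q μ :=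
  h.continuous_gradient.memLp_of_hasCompactSupport
    ((h.2.1.fderiv (𝕜 := ℝ)).comp_left (map_zero _))

lemma IsTestFunction.lpNorm_gradient (h : IsTestFunction Ω φ) (q : ENNReal) :
    lpNorm (gradient φ) q (volume.restrict Ω) = lpNorm (fderiv ℝ φ) q volume := by
  have hzero : ∀ x ∉ Ω, gradient φ x = 0 := fun x hx => by
    rw [← norm_eq_zero, norm_gradient, h.fderiv_eq_zero hx, norm_zero]
  have hfderiv := h.contDiff_one.continuous_fderiv one_ne_zero
  rw [← toReal_eLpNorm h.continuous_gradient.aestronglyMeasurable,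
    ← toReal_eLpNorm hfderiv.aestronglyMeasurable,
    eLpNorm_restrict_eq_of_support_subset (Function.support_subset_iff'.2 hzero),
    eLpNorm_congr_norm_ae (Eventually.of_forall (norm_gradient φ))]

variable {p : ℝ}

lemma IsTestFunction.norm_sub_le_morreyModulus_mul (h : IsTestFunction Ω φ) (hp : 1 ≤ p)
    (hpn : n < p) {r : ℝ} (hr : 0 < r) (x y : EuclideanSpace ℝ (Fin n)) :
    ‖φ x - φ y‖ ≤ morreyModulus (volume : Measure (EuclideanSpace ℝ (Fin n))) p r ‖x - y‖ *
      lpNorm (gradient φ) (ENNReal.ofReal p) (volume.restrict Ω) := by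
  rw [h.lpNorm_gradient]
  exact PTorsion.norm_sub_le_morreyModulus_mul volume h.contDiff_one h.2.1 hp (by simpa) x y hr

lemma IsTestFunction.norm_le_morreyModulus_infDist_mul (h : IsTestFunction Ω φ)
    (hne : Ωᶜ.Nonempty) (hp : 1 ≤ p) (hpn : n < p) {r : ℝ} (hr : 0 < r)
    (x : EuclideanSpace ℝ (Fin n)) :
    ‖φ x‖ ≤ morreyModulus (E := EuclideanSpace ℝ (Fin n)) volume p r (infDist x Ωᶜ) *
      lpNorm (gradient φ) (ENNReal.ofReal p) (volume.restrict Ω) :=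
  PTorsion.norm_le_morreyModulus_infDist_mul volume hne (fun _ => h.eq_zero)
    (h.norm_sub_le_morreyModulus_mul hp hpn hr) x

lemma exists_tendstoUniformly_of_tendsto_lpNorm_gradient_sub (hne : Ωᶜ.Nonempty)
    (hΩ : Bornology.IsBounded Ω) (hp : 1 ≤ p) (hpn : n < p)
    {φ : ℕ → EuclideanSpace ℝ (Fin n) → ℝ} (hφ : ∀ j, IsTestFunction Ω (φ j))
    {G : EuclideanSpace ℝ (Fin n) → EuclideanSpace ℝ (Fin n)}
    (hG : MemLp G (ENNReal.ofReal p) (volume.restrict Ω))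
    (hφG : Tendsto (fun j => lpNorm (gradient (φ j) - G) (ENNReal.ofReal p)
      (volume.restrict Ω)) atTop (𝓝 0)) :
    ∃ v, TendstoUniformly φ v atTop := by
  obtain ⟨D, hD₀, hD⟩ := exists_infDist_compl_le hΩ
  set q := ENNReal.ofReal p
  have hq : 1 ≤ q := ENNReal.one_le_ofReal.2 hp
  set a : ℕ → ℝ := fun j => lpNorm (gradient (φ j) - G) q (volume.restrict Ω)
  have hgrad (j : ℕ) : MemLp (gradient (φ j)) q (volume.restrict Ω) := (hφ j).memLp_gradient _ _
  have hsub (i j : ℕ) :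
      lpNorm (gradient (φ i - φ j)) q (volume.restrict Ω) ≤ a i + a j := by
    rw [(hφ i).gradient_sub (hφ j)]
    exact (lpNorm_sub_le_lpNorm_sub_add_lpNorm_sub (hgrad i) hG hq).trans_eq
      (by rw [lpNorm_sub_comm G])
  set K := morreyModulus (E := EuclideanSpace ℝ (Fin n)) volume p 1 D
  have hK : 0 ≤ K := morreyModulus_nonneg _ (by linarith) (by simpa) zero_le_one hD₀
  refine exists_tendstoUniformly_of_norm_sub_le (b := fun j => K * a j)
    (by simpa using hφG.const_mul K) fun i j x => ?_
  calc ‖φ i x - φ j x‖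
      ≤ morreyModulus (E := EuclideanSpace ℝ (Fin n)) volume p 1 (infDist x Ωᶜ) *
          lpNorm (gradient (φ i - φ j)) q (volume.restrict Ω) :=
        ((hφ i).sub (hφ j)).norm_le_morreyModulus_infDist_mul hne hp hpn one_pos x
    _ ≤ K * (a i + a j) :=
        mul_le_mul (morreyModulus_mono _ p 1 (hD x)) (hsub i j) lpNorm_nonneg hK
    _ = K * a i + K * a j := mul_add _ _ _

theorem MemSobolevZero.exists_continuous_representative {u : EuclideanSpace ℝ (Fin n) → ℝ}
    {G : EuclideanSpace ℝ (Fin n) → EuclideanSpace ℝ (Fin n)} (h : MemSobolevZero p Ω u G)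
    (hne : Ωᶜ.Nonempty) (hΩ : Bornology.IsBounded Ω) (hp : 1 ≤ p) (hpn : n < p) :
    ∃ v : EuclideanSpace ℝ (Fin n) → ℝ, v =ᵐ[volume.restrict Ω] u ∧ Continuous v ∧
      (∀ x ∉ Ω, v x = 0) ∧ ∀ r > 0, ∀ x y, ‖v x - v y‖ ≤
        morreyModulus (E := EuclideanSpace ℝ (Fin n)) volume p r ‖x - y‖ *
          lpNorm G (ENNReal.ofReal p) (volume.restrict Ω) := by
  obtain ⟨⟨hu, hG, -⟩, φ, hφ, hφu, hφG⟩ := h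
  have hq : 1 ≤ ENNReal.ofReal p := ENNReal.one_le_ofReal.2 hp
  have hgrad (j : ℕ) : MemLp (gradient (φ j)) (ENNReal.ofReal p) (volume.restrict Ω) :=
    (hφ j).memLp_gradient _ _
  have hφG' : Tendsto (fun j => lpNorm (gradient (φ j) - G) (ENNReal.ofReal p)
      (volume.restrict Ω)) atTop (𝓝 0) := by
    simp_rw [← toReal_eLpNorm ((hgrad _).sub hG).aestronglyMeasurable]
    exact (ENNReal.tendsto_toReal ENNReal.zero_ne_top).comp hφG
  obtain ⟨v, hv⟩ := exists_tendstoUniformly_of_tendsto_lpNorm_gradient_sub hne hΩ hp hpn hφ hG hφG'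
  refine ⟨v, ?_, ?_, fun x hx => ?_, fun r hr x y => ?_⟩
  · exact ae_eq_of_tendsto_eLpNorm_of_tendsto (one_pos.trans_le hq).ne'
      (fun j => (hφ j).1.continuous.aestronglyMeasurable) hu.aestronglyMeasurable hφu hv.tendsto_at
  · exact hv.continuous (Frequently.of_forall fun j => (hφ j).1.continuous)
  · refine tendsto_nhds_unique (hv.tendsto_at x) ?_
    simp only [(hφ _).eq_zero hx, tendsto_const_nhds_iff]
  · exact le_of_tendsto_of_tendsto' ((hv.tendsto_at x).sub (hv.tendsto_at y)).norm
      ((tendsto_lpNorm_of_tendsto_lpNorm_sub hq hgrad hG hφG').const_mul _)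
      fun j => (hφ j).norm_sub_le_morreyModulus_mul hp hpn hr x y

end Sobolev

section Energy

lemma tendsto_integral_inner {α ι F : Type*} {m : MeasurableSpace α} {μ : Measure α}
    [NormedAddCommGroup F] [InnerProductSpace ℝ F] {l : Filter ι} {p q : ENNReal}
    [p.HolderTriple q 1] {H f : α → F} {g : ι → α → F} (hH : MemLp H p μ) (hf : MemLp f q μ)
    (hg : ∀ i, MemLp (g i) q μ) (h : Tendsto (fun i => eLpNorm (g i - f) q μ) l (𝓝 0)) :
    Tendsto (fun i => ∫ x, inner ℝ (H x) (g i x) ∂μ) l (𝓝 (∫ x, inner ℝ (H x) (f x) ∂μ)) := by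
  have hHolder {k : α → F} (hk : MemLp k q μ) :
      eLpNorm (fun x => inner ℝ (H x) (k x)) 1 μ ≤ eLpNorm H p μ * eLpNorm k q μ := by
    simpa using eLpNorm_le_eLpNorm_mul_eLpNorm'_of_norm (r := 1) hH.1 hk.1
      (fun a b => (inner ℝ a b : ℝ)) 1
      (Eventually.of_forall fun x => by simpa using norm_inner_le_norm (𝕜 := ℝ) (H x) (k x))
  have hint {k : α → F} (hk : MemLp k q μ) : Integrable (fun x => (inner ℝ (H x) (k x) : ℝ)) μ :=
    memLp_one_iff_integrable.1
      ⟨hH.1.inner hk.1, (hHolder hk).trans_lt (ENNReal.mul_lt_top hH.2 hk.2)⟩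
  refine tendsto_integral_of_L1' _ (hint hf).1 (Eventually.of_forall fun i => hint (hg i)) ?_
  have hbound : Tendsto (fun i => eLpNorm H p μ * eLpNorm (g i - f) q μ) l (𝓝 0) := by
    simpa using ENNReal.Tendsto.const_mul h (Or.inr hH.2.ne)
  refine tendsto_of_tendsto_of_tendsto_of_le_of_le tendsto_const_nhds hbound
    (fun _ => zero_le) fun i => ?_
  have hsub : (fun x => inner ℝ (H x) ((g i - f) x)) =
      (fun x => inner ℝ (H x) (g i x)) - fun x => (inner ℝ (H x) (f x) : ℝ) :=
    funext fun x => inner_sub_right _ _ _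
  exact hsub ▸ hHolder ((hg i).sub hf)

lemma norm_rpow_sub_two_smul {F : Type*} [NormedAddCommGroup F] [NormedSpace ℝ F] {p : ℝ}
    (hp : p ≠ 1) (ξ : F) : ‖‖ξ‖ ^ (p - 2) • ξ‖ = ‖ξ‖ ^ (p - 1) := by
  rw [norm_smul, Real.norm_of_nonneg (Real.rpow_nonneg (norm_nonneg _) _),
    ← Real.rpow_add_one' (norm_nonneg ξ) (by contrapose! hp; linarith)]
  congr 1
  ring

section InnerProductSpace

variable {F : Type*} [NormedAddCommGroup F] [InnerProductSpace ℝ F] {p : ℝ}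

lemma inner_rpow_sub_two_smul_self (hp : p ≠ 0) (ξ : F) :
    inner ℝ (‖ξ‖ ^ (p - 2) • ξ) ξ = ‖ξ‖ ^ p := by
  rw [real_inner_smul_left, real_inner_self_eq_norm_sq, ← Real.rpow_two,
    ← Real.rpow_add' (norm_nonneg ξ) (by simpa using hp), sub_add_cancel]

lemma norm_inner_rpow_sub_two_smul_le (hp : 1 < p) (ξ ζ : F) :
    ‖inner ℝ (‖ξ‖ ^ (p - 2) • ξ) ζ‖ ≤ (1 - 1 / p) * ‖ξ‖ ^ p + ‖ζ‖ ^ p / p := by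
  have hYoung := Real.young_inequality_of_nonneg (norm_nonneg ζ)
    (Real.rpow_nonneg (norm_nonneg ξ) (p - 1)) (Real.HolderConjugate.conjExponent hp)
  rw [← Real.rpow_mul (norm_nonneg ξ), Real.conjExponent,
    mul_div_cancel₀ p (sub_ne_zero.2 hp.ne')] at hYoung
  calc ‖inner ℝ (‖ξ‖ ^ (p - 2) • ξ) ζ‖ ≤ ‖‖ξ‖ ^ (p - 2) • ξ‖ * ‖ζ‖ := norm_inner_le_norm _ _
    _ = ‖ζ‖ * ‖ξ‖ ^ (p - 1) := by rw [norm_rpow_sub_two_smul hp.ne', mul_comm]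
    _ ≤ ‖ζ‖ ^ p / p + ‖ξ‖ ^ p / (p / (p - 1)) := hYoung
    _ = (1 - 1 / p) * ‖ξ‖ ^ p + ‖ζ‖ ^ p / p := by
      have : p ≠ 0 := by linarith
      field_simp
      ring

end InnerProductSpace

lemma memLp_rpow_sub_two_smul {α F : Type*} [NormedAddCommGroup F] [NormedSpace ℝ F]
    {m : MeasurableSpace α} {μ : Measure α} {G : α → F} {p : ℝ} (hp : 1 < p)
    (hG : MemLp G (ENNReal.ofReal p) μ) :
    MemLp (fun x => ‖G x‖ ^ (p - 2) • G x) (ENNReal.ofReal p.conjExponent) μ := by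
  have h := hG.norm_rpow_div (ENNReal.ofReal (p - 1))
  rw [ENNReal.toReal_ofReal (by linarith), ← ENNReal.ofReal_div_of_pos (by linarith)] at h
  refine h.congr_norm ?_ (Eventually.of_forall fun x => ?_)
  · exact (hG.1.norm.aemeasurable.pow_const (p - 2)).aestronglyMeasurable.smul hG.1
  · rw [norm_rpow_sub_two_smul hp.ne', Real.norm_of_nonneg (Real.rpow_nonneg (norm_nonneg _) _)]

lemma lpNorm_ofReal_rpow {α F : Type*} {m : MeasurableSpace α} {μ : Measure α}
    [NormedAddCommGroup F] {f : α → F} {p : ℝ} (hp : 0 < p) (hf : AEStronglyMeasurable f μ) :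
    lpNorm f (ENNReal.ofReal p) μ ^ p = ∫ x, ‖f x‖ ^ p ∂μ := by
  rw [lpNorm_eq_integral_norm_rpow_toReal (by simpa using hp) ENNReal.ofReal_ne_top hf,
    ENNReal.toReal_ofReal hp.le, ← Real.rpow_mul (by positivity), inv_mul_cancel₀ hp.ne',
    Real.rpow_one]

variable {n : ℕ} {p : ℝ} {Ω : Set (EuclideanSpace ℝ (Fin n))}
  {u v : EuclideanSpace ℝ (Fin n) → ℝ} {G : EuclideanSpace ℝ (Fin n) → EuclideanSpace ℝ (Fin n)}

/-- `u` is a weak solution of `-Δ_p u = 1` in `Ω`, `u = 0` on `∂Ω`, with weak gradient `G`; thus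
`IsWeakSolution p Ω u` is `∃ G, IsWeakSolutionWithGradient p Ω u G`. -/
def IsWeakSolutionWithGradient (p : ℝ) (Ω : Set (EuclideanSpace ℝ (Fin n)))
    (u : EuclideanSpace ℝ (Fin n) → ℝ) (G : EuclideanSpace ℝ (Fin n) → EuclideanSpace ℝ (Fin n)) :
    Prop :=
  MemSobolevZero p Ω u G ∧
    ∀ η : EuclideanSpace ℝ (Fin n) → ℝ, IsTestFunction Ω η →
      ∫ x in Ω, ‖G x‖ ^ (p - 2) * inner ℝ (G x) (gradient η x) = ∫ x in Ω, η x

namespace IsWeakSolutionWithGradient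

/-- By density, a weak solution may be tested against itself. -/
theorem integral_norm_rpow (h : IsWeakSolutionWithGradient p Ω u G)
    (hΩ : Bornology.IsBounded Ω) (hp : 1 < p) : ∫ x in Ω, ‖G x‖ ^ p = ∫ x in Ω, u x := by
  obtain ⟨⟨⟨hu, hG, -⟩, φ, hφ, hφu, hφG⟩, hweak⟩ := h
  have : IsFiniteMeasure (volume.restrict Ω) := ⟨by simpa using hΩ.measure_lt_top⟩
  have : (ENNReal.ofReal p.conjExponent).HolderTriple (ENNReal.ofReal p) 1 :=
    (Real.HolderConjugate.conjExponent hp).symm.ennrealOfReal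
  have hgrad : Tendsto (fun j => ∫ x in Ω, inner ℝ (‖G x‖ ^ (p - 2) • G x) (gradient (φ j) x))
      atTop (𝓝 (∫ x in Ω, inner ℝ (‖G x‖ ^ (p - 2) • G x) (G x))) :=
    tendsto_integral_inner (memLp_rpow_sub_two_smul hp hG) hG
      (fun j => (hφ j).memLp_gradient _ _) hφG
  have hval : Tendsto (fun j => ∫ x in Ω, φ j x) atTop (𝓝 (∫ x in Ω, u x)) := by
    simpa using tendsto_integral_inner (memLp_const (μ := volume.restrict Ω)
      (p := ENNReal.ofReal p.conjExponent) (1 : ℝ)) hu (fun j => (hφ j).memLp _ _) hφu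
  simp only [inner_rpow_sub_two_smul_self (by linarith : p ≠ 0)] at hgrad
  simp only [real_inner_smul_left, hweak _ (hφ _)] at hgrad
  exact tendsto_nhds_unique hgrad hval

theorem integral_le_integral_add (h : IsWeakSolutionWithGradient p Ω u G)
    (hΩ : Bornology.IsBounded Ω) (hp : 1 < p) {η : EuclideanSpace ℝ (Fin n) → ℝ}
    (hη : IsTestFunction Ω η) (hη₁ : ∀ x, ‖gradient η x‖ ≤ 1) :
    ∫ x in Ω, η x ≤ (∫ x in Ω, u x) + volume.real Ω / p := by
  have hp₀ : 0 < p := by linarith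
  have : IsFiniteMeasure (volume.restrict Ω) := ⟨by simpa using hΩ.measure_lt_top⟩
  have hG : Integrable (fun x => ‖G x‖ ^ p) (volume.restrict Ω) := by
    simpa [ENNReal.toReal_ofReal hp₀.le] using
      h.1.1.2.1.integrable_norm_rpow (by simpa using hp₀) ENNReal.ofReal_ne_top
  have hpointwise (x : EuclideanSpace ℝ (Fin n)) :
      ‖‖G x‖ ^ (p - 2) * inner ℝ (G x) (gradient η x)‖ ≤ ‖G x‖ ^ p + 1 / p := by
    rw [← real_inner_smul_left]
    refine (norm_inner_rpow_sub_two_smul_le hp _ _).trans ?_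
    gcongr
    · exact mul_le_of_le_one_left (by positivity) (sub_le_self _ (by positivity))
    · exact Real.rpow_le_one (norm_nonneg _) (hη₁ x) hp₀.le
  calc ∫ x in Ω, η x = ∫ x in Ω, ‖G x‖ ^ (p - 2) * inner ℝ (G x) (gradient η x) :=
        (h.2 η hη).symm
    _ ≤ ∫ x in Ω, (‖G x‖ ^ p + 1 / p) :=
        (Real.le_norm_self _).trans (norm_integral_le_of_norm_le (hG.add (integrable_const _))
          (Eventually.of_forall hpointwise))
    _ = (∫ x in Ω, u x) + volume.real Ω / p := by
        rw [integral_add hG (integrable_const _), h.integral_norm_rpow hΩ hp]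
        simp [div_eq_mul_inv]

theorem lpNorm_rpow_le (h : IsWeakSolutionWithGradient p Ω u G) (hΩ : Bornology.IsBounded Ω)
    (hp : 1 < p) {C : ℝ} (huv : v =ᵐ[volume.restrict Ω] u) (hv : ∀ x, ‖v x‖ ≤ C) :
    lpNorm G (ENNReal.ofReal p) (volume.restrict Ω) ^ p ≤ C * volume.real Ω := by
  rw [lpNorm_ofReal_rpow (by linarith) h.1.1.2.1.aestronglyMeasurable,
    h.integral_norm_rpow hΩ hp, ← integral_congr_ae huv]
  exact (Real.le_norm_self _).trans
    (norm_setIntegral_le_of_norm_le_const hΩ.measure_lt_top fun x _ => hv x)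

end IsWeakSolutionWithGradient

end Energy

section Approximation

open Metric
open scoped Convolution

section Convolution

variable {E F : Type*} [NormedAddCommGroup E] [NormedSpace ℝ E] [HasContDiffBump E]
  [MeasurableSpace E] [NormedAddCommGroup F] [NormedSpace ℝ F] (μ : Measure E)
  (ρ : ContDiffBump (0 : E))

lemma support_normed_convolution_subset (f : E → F) :
    (ρ.normed μ ⋆[ContinuousLinearMap.lsmul ℝ ℝ, μ] f).support ⊆ thickening ρ.rOut f.support := by
  intro x hx
  obtain ⟨y, hy, t, ht, rfl⟩ := support_convolution_subset_swap _ hx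
  have ht' : t ∈ ball 0 ρ.rOut := by
    by_contra h
    exact ht (by simp [ContDiffBump.normed, ρ.zero_of_le_dist (not_lt.1 h)])
  exact mem_thickening_iff.2 ⟨y, hy, by simpa using ht'⟩

variable [FiniteDimensional ℝ E] [BorelSpace E] [μ.IsAddHaarMeasure]

lemma lipschitzWith_normed_convolution {f : E → F} {K : ℝ≥0} (hf : LipschitzWith K f) :
    LipschitzWith K (ρ.normed μ ⋆[ContinuousLinearMap.lsmul ℝ ℝ, μ] f) := by
  have hint (x : E) : Integrable (fun t => ρ.normed μ t • f (x - t)) μ := by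
    have := ρ.continuous_normed (μ := μ)
    have := hf.continuous
    exact Continuous.integrable_of_hasCompactSupport (by fun_prop)
      ρ.hasCompactSupport_normed.smul_right
  refine LipschitzWith.of_dist_le_mul fun x y => ?_
  calc dist (∫ t, ρ.normed μ t • f (x - t) ∂μ) (∫ t, ρ.normed μ t • f (y - t) ∂μ)
      = ‖∫ t, ρ.normed μ t • (f (x - t) - f (y - t)) ∂μ‖ := by
        simp only [dist_eq_norm, smul_sub, integral_sub (hint x) (hint y)]
    _ ≤ ∫ t, ρ.normed μ t * (K * dist x y) ∂μ := by
        refine norm_integral_le_of_norm_le (ρ.integrable_normed.mul_const _)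
          (Eventually.of_forall fun t => ?_)
        rw [norm_smul, Real.norm_of_nonneg (ρ.nonneg_normed t)]
        refine mul_le_mul_of_nonneg_left ?_ (ρ.nonneg_normed t)
        simpa [dist_eq_norm] using hf.dist_le_mul (x - t) (y - t)
    _ = K * dist x y := by rw [integral_mul_const, ρ.integral_normed, one_mul]

end Convolution

theorem exists_isTestFunction_infDist_sub_le {n : ℕ} {Ω : Set (EuclideanSpace ℝ (Fin n))}
    (hΩ : Bornology.IsBounded Ω) {δ : ℝ} (hδ : 0 < δ) :
    ∃ η, IsTestFunction Ω η ∧ (∀ x, ‖gradient η x‖ ≤ 1) ∧ ∀ x, infDist x Ωᶜ - δ ≤ η x := by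
  have hε : 0 < δ / 3 := by positivity
  have hd : LipschitzWith 1 (infDist · Ωᶜ) := lipschitz_infDist_pt _
  set f : EuclideanSpace ℝ (Fin n) → ℝ := fun x => max (infDist x Ωᶜ - 2 * (δ / 3)) 0
  have hf : LipschitzWith 1 f :=
    (LipschitzWith.of_dist_le_mul fun x y => by simpa using hd.dist_le_mul x y).max_const 0
  let ρ : ContDiffBump (0 : EuclideanSpace ℝ (Fin n)) :=
    ⟨δ / 3 / 2, δ / 3, half_pos hε, half_lt_self hε⟩
  set η := ρ.normed volume ⋆[ContinuousLinearMap.lsmul ℝ ℝ, volume] f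
  have hclosed : IsClosed {x | δ / 3 ≤ infDist x Ωᶜ} := isClosed_le continuous_const hd.continuous
  have hsub : {x | δ / 3 ≤ infDist x Ωᶜ} ⊆ Ω := fun x hx => by
    by_contra hxΩ
    exact hε.not_ge (hx.trans_eq (infDist_zero_of_mem hxΩ))
  have hsupp : η.support ⊆ {x | δ / 3 ≤ infDist x Ωᶜ} := fun x hx => by
    obtain ⟨y, hy, hxy⟩ :=
      mem_thickening_iff.1 (support_normed_convolution_subset volume ρ f hx)
    have hfy : 2 * (δ / 3) < infDist y Ωᶜ := by
      by_contra! h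
      exact hy (max_eq_right (sub_nonpos.2 h))
    rw [dist_comm] at hxy
    change δ / 3 ≤ infDist x Ωᶜ
    have hdist : infDist y Ωᶜ ≤ infDist x Ωᶜ + dist y x := infDist_le_infDist_add_dist
    linarith [show dist y x < δ / 3 from hxy]
  refine ⟨η, ⟨?_, ?_, (closure_minimal hsupp hclosed).trans hsub⟩, fun x => ?_, fun x => ?_⟩
  · exact ρ.hasCompactSupport_normed.contDiff_convolution_left _ ρ.contDiff_normed
      hf.continuous.locallyIntegrable
  · exact .of_support_subset_isCompact
      (isCompact_of_isClosed_isBounded hclosed (hΩ.subset hsub)) hsupp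
  · rw [norm_gradient]
    exact norm_fderiv_le_of_lipschitz ℝ (lipschitzWith_normed_convolution volume ρ hf)
  · have hηf : dist (η x) (f x) ≤ δ / 3 :=
      ρ.dist_normed_convolution_le hf.continuous.aestronglyMeasurable fun y hy => by
        simpa using (hf.dist_le_mul y x).trans (by simpa using (mem_ball.1 hy).le)
    rw [Real.dist_eq, abs_le] at hηf
    linarith [hηf.1, le_max_left (infDist x Ωᶜ - 2 * (δ / 3)) 0]

end Approximation

section UniformConvergence

open Metric

lemma apply_le_add_inv_mul_setIntegral {α : Type*} [MeasurableSpace α] {μ : Measure α}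
    {s : Set α} {f : α → ℝ} {a ε : ℝ} (hs : MeasurableSet s) (hs₀ : μ s ≠ 0) (hs' : μ s ≠ ⊤)
    (hf : IntegrableOn f s μ) (ha : ∀ y ∈ s, a ≤ ε + f y) :
    a ≤ ε + (μ.real s)⁻¹ * ∫ y in s, f y ∂μ := by
  have hpos : 0 < μ.real s := ENNReal.toReal_pos hs₀ hs'
  rw [← sub_le_iff_le_add', le_inv_mul_iff₀' hpos]
  exact setIntegral_ge_of_const_le_real hs hs' (fun y hy => sub_le_iff_le_add'.2 (ha y hy)) hf

variable {E : Type*} [NormedAddCommGroup E] [NormedSpace ℝ E] [FiniteDimensional ℝ E]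
  [MeasurableSpace E] [BorelSpace E] (μ : Measure E) [μ.IsAddHaarMeasure] {ι : Type*}
  {l : Filter ι}

lemma tendstoUniformly_zero_of_tendsto_integral_norm {F : Type*} [NormedAddCommGroup F]
    {f : ι → E → F} (hf : ∀ᶠ i in l, Integrable (f i) μ)
    (hequi : ∀ ε > 0, ∃ r > 0, ∀ᶠ i in l, ∀ x, ∀ y ∈ ball x r, ‖f i x - f i y‖ ≤ ε)
    (hint : Tendsto (fun i => ∫ x, ‖f i x‖ ∂μ) l (𝓝 0)) : TendstoUniformly f 0 l := by
  refine Metric.tendstoUniformly_iff.2 fun δ hδ => ?_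
  obtain ⟨r, hr, hr'⟩ := hequi (δ / 2) (half_pos hδ)
  have hlim : Tendsto (fun i => (μ.real (ball (0 : E) r))⁻¹ * ∫ x, ‖f i x‖ ∂μ) l (𝓝 0) := by
    simpa using hint.const_mul _
  filter_upwards [hf, hr', hlim.eventually_lt_const (half_pos hδ)] with i hi hosc hsmall x
  have hball := apply_le_add_inv_mul_setIntegral measurableSet_ball (measure_ball_pos μ x hr).ne'
    measure_ball_lt_top.ne hi.norm.integrableOn fun y hy =>
      (norm_le_norm_sub_add (f i x) (f i y)).trans (add_le_add_left (hosc x y hy) _)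
  have hmono : ∫ y in ball x r, ‖f i y‖ ∂μ ≤ ∫ y, ‖f i y‖ ∂μ :=
    setIntegral_le_integral hi.norm (Eventually.of_forall fun _ => norm_nonneg _)
  rw [Measure.addHaar_real_ball_center] at hball
  rw [Pi.zero_apply, dist_zero_left]
  calc ‖f i x‖ ≤ δ / 2 + (μ.real (ball (0 : E) r))⁻¹ * ∫ y in ball x r, ‖f i y‖ ∂μ := hball
    _ ≤ δ / 2 + (μ.real (ball (0 : E) r))⁻¹ * ∫ y, ‖f i y‖ ∂μ := by gcongr
    _ < δ := by linarith

variable {Ω : Set E} {v : E → ℝ} {ε : ℝ}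

lemma integral_norm_infDist_sub_le (hΩ : Bornology.IsBounded Ω) (hv : Continuous v)
    (hv₀ : ∀ x ∉ Ω, v x = 0) (hε : 0 ≤ ε) (hle : ∀ x, v x ≤ infDist x Ωᶜ + ε) :
    ∫ x, ‖infDist x Ωᶜ - v x‖ ∂μ ≤
      ∫ x in Ω, infDist x Ωᶜ ∂μ - ∫ x in Ω, v x ∂μ + 2 * ε * μ.real Ω := by
  have : IsFiniteMeasure (μ.restrict Ω) := ⟨by simpa using hΩ.measure_lt_top⟩
  have hcont {f : E → ℝ} (hf : Continuous f) : IntegrableOn f Ω μ :=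
    (hf.continuousOn.integrableOn_compact hΩ.isCompact_closure).mono_set subset_closure
  have hd : Continuous fun x => infDist x Ωᶜ := continuous_infDist_pt _
  calc ∫ x, ‖infDist x Ωᶜ - v x‖ ∂μ = ∫ x in Ω, ‖infDist x Ωᶜ - v x‖ ∂μ :=
        (setIntegral_eq_integral_of_forall_compl_eq_zero fun x hx => by
          rw [hv₀ x hx, infDist_zero_of_mem (s := Ωᶜ) hx, sub_zero, norm_zero]).symm
    _ ≤ ∫ x in Ω, (infDist x Ωᶜ - v x + 2 * ε) ∂μ := by
        refine integral_mono (hcont (by fun_prop)) (hcont (by fun_prop)) fun x => ?_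
        exact abs_le.2 ⟨by linarith [hle x], by linarith⟩
    _ = _ := by
        rw [integral_add (f := fun x => infDist x Ωᶜ - v x) (hcont (hd.sub hv))
          (integrable_const _), integral_sub (hcont hd) (hcont hv), setIntegral_const,
          smul_eq_mul, mul_comm]

lemma tendsto_zero_of_forall_eventually_le_mul {f : ι → ℝ} (C : ℝ) (hf : ∀ i, 0 ≤ f i)
    (h : ∀ ε > 0, ∀ᶠ i in l, f i ≤ ε * C) : Tendsto f l (𝓝 0) := by
  refine tendsto_order.2 ⟨fun a ha => Eventually.of_forall fun i => ha.trans_le (hf i), ?_⟩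
  intro a ha
  have hC : Tendsto (fun ε : ℝ => ε * C) (𝓝[>] 0) (𝓝 0) :=
    tendsto_nhdsWithin_of_tendsto_nhds (by simpa using (continuous_mul_const C).tendsto 0)
  obtain ⟨ε, hε, hεa⟩ := (eventually_mem_nhdsWithin.and (hC.eventually_lt_const ha)).exists
  exact (h ε hε).mono fun i hi => hi.trans_lt hεa

/-- The almost-Lipschitz bound forces `v i ≤ infDist · Ωᶜ + o(1)`, so the lower bound on the
integrals makes `infDist · Ωᶜ - v i` small in `L¹`, hence, being equicontinuous, uniformly. -/
theorem tendstoUniformly_infDist_compl {v : ι → E → ℝ} (hΩ : Bornology.IsBounded Ω)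
    (hne : Ωᶜ.Nonempty) (hv : ∀ᶠ i in l, Continuous (v i))
    (hv₀ : ∀ᶠ i in l, ∀ x ∉ Ω, v i x = 0)
    (hlip : ∀ ε > 0, ∀ᶠ i in l, ∀ x y, ‖v i x - v i y‖ ≤ ε + (1 + ε) * ‖x - y‖)
    (hint : ∀ ε > 0, ∀ᶠ i in l, ∫ x in Ω, infDist x Ωᶜ ∂μ - ε ≤ ∫ x in Ω, v i x ∂μ) :
    TendstoUniformly v (infDist · Ωᶜ) l := by
  obtain ⟨D, hD₀, hD⟩ := exists_infDist_compl_le hΩ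
  have hdist : Continuous (infDist · Ωᶜ) := continuous_infDist_pt _
  suffices h : TendstoUniformly (fun i x => infDist x Ωᶜ - v i x) 0 l by
    simpa [Metric.tendstoUniformly_iff, dist_eq_norm, abs_sub_comm] using h
  refine tendstoUniformly_zero_of_tendsto_integral_norm μ ?_ (fun ε hε => ?_) ?_
  · filter_upwards [hv, hv₀] with i hi hi₀
    refine (hdist.sub hi).integrable_of_hasCompactSupport
      ((hasCompactSupport_infDist_compl hΩ).sub ?_)
    exact .of_support_subset_isCompact hΩ.isCompact_closure
      ((Function.support_subset_iff'.2 hi₀).trans subset_closure)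
  · refine ⟨ε / 6, by positivity, ?_⟩
    filter_upwards [hlip (min (ε / 2) 1) (by positivity)] with i hi x y hy
    have hxy : ‖x - y‖ ≤ ε / 6 := by simpa [dist_eq_norm, norm_sub_rev] using (mem_ball.1 hy).le
    have hd : ‖infDist x Ωᶜ - infDist y Ωᶜ‖ ≤ ‖x - y‖ := by
      simpa [dist_eq_norm] using (lipschitz_infDist_pt Ωᶜ).dist_le_mul x y
    have hvi : ‖v i x - v i y‖ ≤ ε / 2 + 2 * ‖x - y‖ := (hi x y).trans (by
      gcongr
      · exact min_le_left _ _
      · linarith [min_le_right (ε / 2) 1])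
    rw [sub_sub_sub_comm]
    linarith [norm_sub_le (infDist x Ωᶜ - infDist y Ωᶜ) (v i x - v i y)]
  · refine tendsto_zero_of_forall_eventually_le_mul (1 + 2 * (1 + D) * μ.real Ω)
      (fun i => integral_nonneg fun _ => norm_nonneg _) fun ε hε => ?_
    filter_upwards [hv, hv₀, hlip ε hε, hint ε hε] with i hv hv₀ hlip hint
    have hle (x : E) : v i x ≤ infDist x Ωᶜ + ε * (1 + D) := by
      have hvx : ‖v i x‖ ≤ ε + (1 + ε) * infDist x Ωᶜ :=
        norm_le_comp_infDist (m := fun s => ε + (1 + ε) * s) hne hv₀ (by fun_prop)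
          fun y _ => dist_eq_norm x y ▸ hlip x y
      nlinarith [Real.le_norm_self (v i x), hD x]
    linarith [integral_norm_infDist_sub_le μ hΩ hv hv₀ (by positivity) hle]

end UniformConvergence

section Touching

open Metric

variable {E : Type*} [NormedAddCommGroup E] [NormedSpace ℝ E] {v w : E → ℝ} {x e : E} {c C : ℝ}

lemma tendsto_add_smul (x e : E) : Tendsto (fun t : ℝ => x + t • e) (𝓝 0) (𝓝 x) := by
  have : Continuous fun t : ℝ => x + t • e := by fun_prop
  simpa using this.tendsto 0

lemma le_fderiv_apply_of_eventually (hv : DifferentiableAt ℝ v x)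
    (h : ∀ᶠ t : ℝ in 𝓝[>] 0, v x + t * c ≤ v (x + t • e)) : c ≤ fderiv ℝ v x e := by
  refine ge_of_tendsto (hv.hasFDerivAt.hasLineDerivAt e).tendsto_slope_zero_right ?_
  filter_upwards [h, self_mem_nhdsWithin] with t ht ht₀
  rw [smul_eq_mul, le_inv_mul_iff₀ ht₀]
  linarith

lemma norm_fderiv_le_of_eventually_sub_mul_le (hv : DifferentiableAt ℝ v x) (hC : 0 ≤ C)
    (h : ∀ᶠ y in 𝓝 x, v x - C * ‖y - x‖ ≤ v y) : ‖fderiv ℝ v x‖ ≤ C := by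
  have hbelow (e : E) : -(C * ‖e‖) ≤ fderiv ℝ v x e := by
    refine le_fderiv_apply_of_eventually hv ?_
    filter_upwards [((tendsto_add_smul x e).eventually h).filter_mono nhdsWithin_le_nhds,
      self_mem_nhdsWithin] with t ht ht₀
    rw [add_sub_cancel_left, norm_smul, Real.norm_of_nonneg (le_of_lt ht₀)] at ht
    linarith
  refine ContinuousLinearMap.opNorm_le_bound _ hC fun e => abs_le.2 ⟨hbelow e, ?_⟩
  simpa [neg_le_neg_iff] using hbelow (-e)

lemma norm_fderiv_le_of_lipschitzWith_of_eventually_le {K : ℝ≥0} {u : E → ℝ}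
    (hu : LipschitzWith K u) (hv : DifferentiableAt ℝ v x) (hx : v x = u x)
    (h : ∀ᶠ y in 𝓝 x, u y ≤ v y) : ‖fderiv ℝ v x‖ ≤ K := by
  refine norm_fderiv_le_of_eventually_sub_mul_le hv K.2 ?_
  filter_upwards [h] with y hy
  have := hu.le_add_mul x y
  rw [dist_comm, dist_eq_norm] at this
  linarith

lemma norm_fderiv_le_of_lipschitzWith_of_eventually_ge {K : ℝ≥0} {u : E → ℝ}
    (hu : LipschitzWith K u) (hw : DifferentiableAt ℝ w x) (hx : w x = u x)
    (h : ∀ᶠ y in 𝓝 x, w y ≤ u y) : ‖fderiv ℝ w x‖ ≤ K := by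
  simpa [fderiv_neg] using norm_fderiv_le_of_lipschitzWith_of_eventually_le (v := -w) hu.neg hw.neg
    (by simpa using hx) (h.mono fun y hy => by simpa using hy)

lemma deriv_deriv_nonpos_of_isLocalMax {f : ℝ → ℝ} {a : ℝ} (hf : ContinuousAt f a)
    (hmax : IsLocalMax f a) : deriv (deriv f) a ≤ 0 := by
  by_contra! hpos
  have hmin := isLocalMin_of_deriv_deriv_pos hpos hmax.deriv_eq_zero hf
  have hconst : f =ᶠ[𝓝 a] fun _ => f a := by
    filter_upwards [hmax, hmin] with t h₁ h₂ using le_antisymm h₁ h₂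
  exact hpos.ne' (by simpa using hconst.deriv.deriv_eq)

lemma deriv_deriv_nonpos_of_eventually_le {f : ℝ → ℝ} {a c : ℝ}
    (hf : ∀ᶠ t in 𝓝 a, DifferentiableAt ℝ f t) (h : ∀ᶠ t in 𝓝 a, f t ≤ f a + (t - a) * c) :
    deriv (deriv f) a ≤ 0 := by
  have hmax : IsLocalMax (fun t => f t - (t - a) * c) a := by
    filter_upwards [h] with t ht
    linarith
  have hderiv : deriv (fun t => f t - (t - a) * c) =ᶠ[𝓝 a] fun t => deriv f t - c := by
    filter_upwards [hf] with t ht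
    simpa using (ht.hasDerivAt.fun_sub (((hasDerivAt_id t).sub_const a).mul_const c)).deriv
  have hcont : ContinuousAt (fun t => f t - (t - a) * c) a :=
    hf.self_of_nhds.continuousAt.sub (by fun_prop)
  simpa [hderiv.deriv_eq] using deriv_deriv_nonpos_of_isLocalMax hcont hmax

lemma hasDerivAt_comp_add_smul {t : ℝ} (hw : DifferentiableAt ℝ w (x + t • e)) :
    HasDerivAt (fun t : ℝ => w (x + t • e)) (fderiv ℝ w (x + t • e) e) t :=
  hw.hasFDerivAt.comp_hasDerivAt t
    ((((hasDerivAt_id t).smul_const e).const_add x).congr_deriv (one_smul ℝ e))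

lemma fderiv_fderiv_apply_nonpos_of_eventually_le (hw : ContDiffAt ℝ 2 w x)
    (h : ∀ᶠ t : ℝ in 𝓝 0, w (x + t • e) ≤ w x + t * c) :
    fderiv ℝ (fderiv ℝ w) x e e ≤ 0 := by
  have hdiff : ∀ᶠ t : ℝ in 𝓝 0, DifferentiableAt ℝ w (x + t • e) :=
    (tendsto_add_smul x e).eventually
      ((hw.eventually (by simp)).mono fun y hy => hy.differentiableAt two_ne_zero)
  have hderiv : deriv (fun t : ℝ => w (x + t • e)) =ᶠ[𝓝 0] fun t => fderiv ℝ w (x + t • e) e :=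
    hdiff.mono fun t ht => (hasDerivAt_comp_add_smul ht).deriv
  have hfderiv : DifferentiableAt ℝ (fderiv ℝ w) x :=
    (hw.fderiv_right (m := 1) (by norm_num)).differentiableAt one_ne_zero
  have hderiv₂ : HasDerivAt (fun t : ℝ => fderiv ℝ w (x + t • e) e)
      (fderiv ℝ (fderiv ℝ w) x e e) 0 := by
    have h := hfderiv.hasFDerivAt.clm_apply (hasFDerivAt_const e x)
    exact HasDerivAt.congr_deriv (h.hasLineDerivAt e) (by simp)
  rw [← hderiv₂.deriv, ← hderiv.deriv_eq]
  exact deriv_deriv_nonpos_of_eventually_le (c := c)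
    (hdiff.mono fun t ht => (hasDerivAt_comp_add_smul ht).differentiableAt) (by simpa using h)

lemma exists_norm_eq_one_infDist_add_smul_le [ProperSpace E] {s : Set E} (hs : IsClosed s)
    (hne : s.Nonempty) (hx : x ∉ s) :
    ∃ e : E, ‖e‖ = 1 ∧ ∀ t ≤ infDist x s, infDist (x + t • e) s ≤ infDist x s - t := by
  obtain ⟨y, hy, hxy⟩ := hs.exists_infDist_eq_dist hne x
  have hpos : 0 < infDist x s := (hs.notMem_iff_infDist_pos hne).1 hx
  have hnorm : ‖y - x‖ = infDist x s := by rw [hxy, dist_eq_norm, norm_sub_rev]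
  set d := infDist x s
  have he : ‖d⁻¹ • (y - x)‖ = 1 := by
    rw [norm_smul, hnorm, norm_inv, Real.norm_of_nonneg hpos.le, inv_mul_cancel₀ hpos.ne']
  refine ⟨d⁻¹ • (y - x), he, fun t ht => ?_⟩
  have hsub : x + t • d⁻¹ • (y - x) - y = (t - d) • d⁻¹ • (y - x) := by
    rw [sub_smul, smul_inv_smul₀ hpos.ne']
    abel
  refine (infDist_le_dist_of_mem hy).trans_eq ?_
  rw [dist_eq_norm, hsub, norm_smul, he, mul_one, Real.norm_of_nonpos (by linarith), neg_sub]

end Touching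

section Viscosity

open Metric

variable {n : ℕ} {Ω : Set (EuclideanSpace ℝ (Fin n))} {v w : EuclideanSpace ℝ (Fin n) → ℝ}
  {x : EuclideanSpace ℝ (Fin n)}

lemma TouchesFromAbove.norm_gradient_le {u : EuclideanSpace ℝ (Fin n) → ℝ} {K : ℝ≥0}
    (h : TouchesFromAbove v u x) (hu : LipschitzWith K u) : ‖gradient v x‖ ≤ K := by
  rw [norm_gradient]
  exact norm_fderiv_le_of_lipschitzWith_of_eventually_le hu (h.1.differentiableAt two_ne_zero)
    h.2.1 h.2.2

lemma TouchesFromBelow.norm_gradient_le {u : EuclideanSpace ℝ (Fin n) → ℝ} {K : ℝ≥0}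
    (h : TouchesFromBelow w u x) (hu : LipschitzWith K u) : ‖gradient w x‖ ≤ K := by
  rw [norm_gradient]
  exact norm_fderiv_le_of_lipschitzWith_of_eventually_ge hu (h.1.differentiableAt two_ne_zero)
    h.2.1 h.2.2

/-- Along the segment from `x` to its nearest point in `Ωᶜ` the distance decreases with slope
exactly `1`, which forces `∇w(x)` to point away from that nearest point. -/
lemma TouchesFromBelow.norm_gradient_eq_one_and_hessian_nonpos
    (h : TouchesFromBelow w (infDist · Ωᶜ) x) (hΩ : IsOpen Ω) (hne : Ωᶜ.Nonempty) (hx : x ∈ Ω) :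
    ‖gradient w x‖ = 1 ∧ hessian w x (gradient w x) (gradient w x) ≤ 0 := by
  have hle : ‖gradient w x‖ ≤ 1 := h.norm_gradient_le (lipschitz_infDist_pt _)
  have hx' : x ∉ Ωᶜ := Set.notMem_compl_iff.2 hx
  obtain ⟨hw, hwx, hbelow⟩ := h
  obtain ⟨e, he, hray⟩ := exists_norm_eq_one_infDist_add_smul_le hΩ.isClosed_compl hne hx'
  have hslope : ∀ᶠ t : ℝ in 𝓝 0, w (x + t • e) ≤ w x + t * -1 := by
    filter_upwards [(tendsto_add_smul x e).eventually hbelow,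
      Iic_mem_nhds ((hΩ.isClosed_compl.notMem_iff_infDist_pos hne).1 hx')] with t ht htd
    linarith [hray t htd]
  have hinner : inner ℝ (gradient w x) e ≤ -1 := by
    have hneg := le_fderiv_apply_of_eventually (v := -w) (e := e) (c := 1)
      (hw.differentiableAt two_ne_zero).neg ((hslope.filter_mono nhdsWithin_le_nhds).mono
        fun t ht => by simp only [Pi.neg_apply]; linarith)
    rw [fderiv_neg] at hneg
    simpa [gradient] using neg_le_neg hneg
  have hnorm : ‖gradient w x‖ = 1 := by
    have := (neg_le_abs _).trans (abs_real_inner_le_norm (gradient w x) e)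
    exact hle.antisymm (by rw [he, mul_one] at this; linarith)
  have hgrad : gradient w x = -e := by
    refine (inner_eq_neg_one_iff_of_norm_eq_one (𝕜 := ℝ) hnorm he).1 (hinner.antisymm ?_)
    have := neg_le_of_abs_le (abs_real_inner_le_norm (gradient w x) e)
    rwa [hnorm, he, mul_one] at this
  refine ⟨hnorm, ?_⟩
  simpa [hgrad, hessian] using fderiv_fderiv_apply_nonpos_of_eventually_le hw hslope

theorem isViscositySolution_infDist_compl (hΩ : IsOpen Ω) (hne : Ωᶜ.Nonempty) :
    IsViscositySolution limitOperator Ω (infDist · Ωᶜ) := by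
  have hcont : Continuous (infDist · Ωᶜ) := continuous_infDist_pt _
  refine ⟨⟨hcont.upperSemicontinuous.upperSemicontinuousOn _, fun x _ v hv => ?_⟩,
    ⟨hcont.lowerSemicontinuous.lowerSemicontinuousOn _, fun x hx w hw => ?_⟩⟩
  · exact (min_le_left _ _).trans
      (sub_nonpos.2 (hv.norm_gradient_le (lipschitz_infDist_pt _)))
  · obtain ⟨hgrad, hhess⟩ := hw.norm_gradient_eq_one_and_hessian_nonpos hΩ hne hx
    exact le_min (sub_nonneg.2 hgrad.ge) (neg_nonneg.2 hhess)

lemma IsViscositySupersolution.eikonal_of_limitOperator {u : EuclideanSpace ℝ (Fin n) → ℝ}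
    (h : IsViscositySupersolution limitOperator Ω u) :
    IsViscositySupersolution eikonalOperator Ω u :=
  ⟨h.1, fun x hx w hw => (h.2 x hx w hw).trans (min_le_left _ _)⟩

end Viscosity

section Limit

open Metric

lemma le_rpow_of_rpow_le_mul {M C p : ℝ} (hp : 1 < p) (hM : 0 ≤ M) (hC : 0 ≤ C)
    (h : M ^ p ≤ C * M) : M ≤ C ^ (1 / (p - 1)) := by
  obtain rfl | hM := hM.eq_or_lt
  · exact Real.rpow_nonneg hC _
  · rw [one_div, Real.le_rpow_inv_iff_of_pos hM.le hC (sub_pos.2 hp), Real.rpow_sub_one hM.ne']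
    exact (div_le_iff₀ hM).2 h

lemma compl_nonempty_of_isBounded {E : Type*} [NormedAddCommGroup E] [NormedSpace ℝ E]
    [Nontrivial E] {s : Set E} (hs : Bornology.IsBounded s) : sᶜ.Nonempty := by
  rw [Set.nonempty_compl]
  rintro rfl
  exact NormedSpace.unbounded_univ ℝ E hs

variable {n : ℕ} {Ω : Set (EuclideanSpace ℝ (Fin n))}

theorem IsWeakSolutionWithGradient.lpNorm_le_rpow {p B : ℝ}
    {u v : EuclideanSpace ℝ (Fin n) → ℝ} {G : EuclideanSpace ℝ (Fin n) → EuclideanSpace ℝ (Fin n)}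
    (h : IsWeakSolutionWithGradient p Ω u G) (hΩ : Bornology.IsBounded Ω) (hp : 1 < p)
    (huv : v =ᵐ[volume.restrict Ω] u) (hB : 0 ≤ B)
    (hv : ∀ x, ‖v x‖ ≤ B * lpNorm G (ENNReal.ofReal p) (volume.restrict Ω)) :
    lpNorm G (ENNReal.ofReal p) (volume.restrict Ω) ≤ (B * volume.real Ω) ^ (1 / (p - 1)) :=
  le_rpow_of_rpow_le_mul hp lpNorm_nonneg (by positivity)
    ((h.lpNorm_rpow_le hΩ hp huv hv).trans_eq (mul_right_comm _ _ _))

variable {ι : Type*} {l : Filter ι} {p : ι → ℝ} {u v : ι → EuclideanSpace ℝ (Fin n) → ℝ}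
  {G : ι → EuclideanSpace ℝ (Fin n) → EuclideanSpace ℝ (Fin n)}

lemma tendsto_const_rpow_one_div_sub_one {C : ℝ} (hC : C ≠ 0) (hp : Tendsto p l atTop) :
    Tendsto (fun i => C ^ (1 / (p i - 1))) l (𝓝 1) := by
  have hinv : Tendsto (fun i => 1 / (p i - 1)) l (𝓝 0) := by
    simpa [sub_eq_add_neg, Pi.inv_def] using
      (tendsto_atTop_add_const_right l (-1) hp).inv_tendsto_atTop
  simpa using tendsto_const_nhds.rpow hinv (Or.inl hC)

theorem exists_eventually_lpNorm_le_rpow (hΩ : Bornology.IsBounded Ω) (hne : Ωᶜ.Nonempty)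
    (hp : Tendsto p l atTop)
    (h : ∀ᶠ i in l, IsWeakSolutionWithGradient (p i) Ω (u i) (G i))
    (huv : ∀ᶠ i in l, v i =ᵐ[volume.restrict Ω] u i) (hv₀ : ∀ᶠ i in l, ∀ x ∉ Ω, v i x = 0)
    (hmod : ∀ᶠ i in l, ∀ r > 0, ∀ x y, ‖v i x - v i y‖ ≤
      morreyModulus (E := EuclideanSpace ℝ (Fin n)) volume (p i) r ‖x - y‖ *
        lpNorm (G i) (ENNReal.ofReal (p i)) (volume.restrict Ω)) :
    ∃ C > 0, ∀ᶠ i in l,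
      lpNorm (G i) (ENNReal.ofReal (p i)) (volume.restrict Ω) ≤ C ^ (1 / (p i - 1)) := by
  obtain ⟨D, hD₀, hD⟩ := exists_infDist_compl_le hΩ
  obtain ⟨r, hr, hmodulus⟩ := eventually_morreyModulus_mul_le
    (volume : Measure (EuclideanSpace ℝ (Fin n))) hp tendsto_const_nhds one_pos
  set B : ℝ := 1 + (1 + 1) * D
  refine ⟨B * volume.real Ω + 1, by positivity, ?_⟩
  filter_upwards [h, huv, hv₀, hmod, hmodulus, hp.eventually_gt_atTop 1]
    with i h huv hv₀ hmod hmodulus hp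
  have hbound (x : EuclideanSpace ℝ (Fin n)) :
      ‖v i x‖ ≤ B * lpNorm (G i) (ENNReal.ofReal (p i)) (volume.restrict Ω) := by
    refine (norm_le_morreyModulus_infDist_mul volume hne hv₀ (hmod r hr) x).trans
      (mul_le_mul_of_nonneg_right ?_ lpNorm_nonneg)
    have := hmodulus D hD₀
    rw [mul_one] at this
    exact (morreyModulus_mono volume (p i) r (hD x)).trans this
  refine (h.lpNorm_le_rpow hΩ hp huv (by positivity) hbound).trans ?_
  have : 0 ≤ p i - 1 := by linarith
  gcongr
  exact le_add_of_nonneg_right zero_le_one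

theorem eventually_norm_sub_le (hΩ : Bornology.IsBounded Ω) (hne : Ωᶜ.Nonempty)
    (hp : Tendsto p l atTop)
    (h : ∀ᶠ i in l, IsWeakSolutionWithGradient (p i) Ω (u i) (G i))
    (huv : ∀ᶠ i in l, v i =ᵐ[volume.restrict Ω] u i) (hv₀ : ∀ᶠ i in l, ∀ x ∉ Ω, v i x = 0)
    (hmod : ∀ᶠ i in l, ∀ r > 0, ∀ x y, ‖v i x - v i y‖ ≤
      morreyModulus (E := EuclideanSpace ℝ (Fin n)) volume (p i) r ‖x - y‖ *
        lpNorm (G i) (ENNReal.ofReal (p i)) (volume.restrict Ω)) {ε : ℝ} (hε : 0 < ε) :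
    ∀ᶠ i in l, ∀ x y, ‖v i x - v i y‖ ≤ ε + (1 + ε) * ‖x - y‖ := by
  obtain ⟨C, hC, hG⟩ := exists_eventually_lpNorm_le_rpow hΩ hne hp h huv hv₀ hmod
  obtain ⟨r, hr, hmodulus⟩ := eventually_morreyModulus_mul_le
    (volume : Measure (EuclideanSpace ℝ (Fin n))) hp (tendsto_const_rpow_one_div_sub_one hC.ne' hp)
    hε
  filter_upwards [hmod, hG, hmodulus, hp.eventually_gt_atTop 0, hp.eventually_gt_atTop (n : ℝ)]
    with i hmod hG hmodulus hp₀ hpn x y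
  calc ‖v i x - v i y‖ ≤ _ := hmod r hr x y
    _ ≤ morreyModulus volume (p i) r ‖x - y‖ * C ^ (1 / (p i - 1)) :=
        mul_le_mul_of_nonneg_left hG
          (morreyModulus_nonneg volume hp₀ (by simpa using hpn) hr.le (norm_nonneg _))
    _ ≤ ε + (1 + ε) * ‖x - y‖ := hmodulus _ (norm_nonneg _)

theorem eventually_integral_infDist_sub_le (hΩ : Bornology.IsBounded Ω)
    (hp : Tendsto p l atTop)
    (h : ∀ᶠ i in l, IsWeakSolutionWithGradient (p i) Ω (u i) (G i)) {ε : ℝ} (hε : 0 < ε) :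
    ∀ᶠ i in l, (∫ x in Ω, infDist x Ωᶜ) - ε ≤ ∫ x in Ω, u i x := by
  set V := volume.real Ω
  have : 0 ≤ V := measureReal_nonneg
  have : IsFiniteMeasure (volume.restrict Ω) := ⟨by simpa using hΩ.measure_lt_top⟩
  obtain ⟨η, hη, hη₁, hle⟩ :=
    exists_isTestFunction_infDist_sub_le hΩ (by positivity : 0 < ε / 2 / (V + 1))
  have hδ : V * (ε / 2 / (V + 1)) ≤ ε / 2 := by
    rw [← mul_div_assoc, div_le_iff₀ (by positivity)]
    linarith
  have hdist : IntegrableOn (infDist · Ωᶜ) Ω :=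
    ((continuous_infDist_pt Ωᶜ).integrable_of_hasCompactSupport
      (hasCompactSupport_infDist_compl hΩ)).integrableOn
  filter_upwards [h, hp.eventually_gt_atTop 1,
    (hp.const_div_atTop V).eventually_le_const (by positivity : 0 < ε / 2)] with i h hp hVp
  have hint : ∫ x in Ω, (infDist x Ωᶜ - ε / 2 / (V + 1)) ≤ ∫ x in Ω, η x :=
    integral_mono (hdist.sub (integrable_const _)) (memLp_one_iff_integrable.1 (hη.memLp _ _)) hle
  rw [integral_sub hdist (integrable_const _), setIntegral_const, smul_eq_mul] at hint
  linarith [h.integral_le_integral_add hΩ hp hη hη₁]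

theorem exists_tendstoUniformly_infDist_of_isWeakSolution (hΩ : Bornology.IsBounded Ω)
    (hne : Ωᶜ.Nonempty) (hp : Tendsto p l atTop)
    (hu : ∀ᶠ i in l, IsWeakSolution (p i) Ω (u i)) :
    ∃ v : ι → EuclideanSpace ℝ (Fin n) → ℝ,
      (∀ᶠ i in l, v i =ᵐ[volume.restrict Ω] u i ∧ Continuous (v i) ∧ ∀ x ∉ Ω, v i x = 0) ∧
      TendstoUniformly v (infDist · Ωᶜ) l := by
  obtain ⟨G, hG⟩ := skolem.1 hu
  replace hG : ∀ᶠ i in l, IsWeakSolutionWithGradient (p i) Ω (u i) (G i) := hG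
  have hrep := skolem.1 (hG.mp ((hp.eventually_gt_atTop (max 1 n)).mono fun i hpi h =>
    h.1.exists_continuous_representative hne hΩ ((le_max_left _ _).trans hpi.le)
      ((le_max_right _ _).trans_lt hpi)))
  obtain ⟨v, hv⟩ := hrep
  refine ⟨v, hv.mono fun i h => ⟨h.1, h.2.1, h.2.2.1⟩, ?_⟩
  have huv := hv.mono fun i h => h.1
  have hv₀ := hv.mono fun i h => h.2.2.1
  refine tendstoUniformly_infDist_compl volume hΩ hne (hv.mono fun i h => h.2.1) hv₀
    (fun ε hε => eventually_norm_sub_le hΩ hne hp hG huv hv₀ (hv.mono fun i h => h.2.2.2) hε)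
    fun ε hε => ?_
  filter_upwards [eventually_integral_infDist_sub_le hΩ hp hG hε, huv] with i hint huv
  exact hint.trans_eq (integral_congr_ae huv).symm

end Limit

end PTorsion

theorem mainTheorem6 (n : ℕ) (hn : 1 ≤ n)
    (Ω : Set (EuclideanSpace ℝ (Fin n))) (hΩo : IsOpen Ω) (hΩb : Bornology.IsBounded Ω)
    (p : ℕ → ℝ) (hp : ∀ k, 1 < p k) (hp_top : Tendsto p atTop atTop)
    (u : ℕ → EuclideanSpace ℝ (Fin n) → ℝ)
    (hu : ∀ k, PTorsion.IsWeakSolution (p k) Ω (u k)) :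
    ∃ (σ : ℕ → ℕ) (v : ℕ → EuclideanSpace ℝ (Fin n) → ℝ)
      (uinf : EuclideanSpace ℝ (Fin n) → ℝ),
      StrictMono σ ∧
      (∀ k, v k =ᵐ[volume.restrict Ω] u (σ k) ∧ ContinuousOn (v k) (closure Ω) ∧
        ∀ x ∈ frontier Ω, v k x = 0) ∧
      TendstoUniformlyOn v uinf atTop (closure Ω) ∧
      (∃ C α : ℝ≥0, 0 < α ∧ α ≤ 1 ∧ HolderOnWith C α uinf (closure Ω)) ∧
      PTorsion.IsViscositySolution PTorsion.limitOperator Ω uinf ∧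
      (∀ x ∈ frontier Ω, uinf x = 0) ∧
      PTorsion.IsViscositySupersolution PTorsion.eikonalOperator Ω uinf := by
  have : Nonempty (Fin n) := ⟨⟨0, hn⟩⟩
  have hne : Ωᶜ.Nonempty := PTorsion.compl_nonempty_of_isBounded hΩb
  have hfrontier : ∀ x ∈ frontier Ω, x ∉ Ω := fun x hx => (hΩo.frontier_eq ▸ hx).2
  have hvisc := PTorsion.isViscositySolution_infDist_compl hΩo hne
  obtain ⟨v, hv, hlim⟩ := PTorsion.exists_tendstoUniformly_infDist_of_isWeakSolution hΩb hne hp_top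
    (Eventually.of_forall hu)
  obtain ⟨K, hK⟩ := eventually_atTop.1 hv
  refine ⟨(· + K), fun k => v (k + K), (Metric.infDist · Ωᶜ), fun _ _ h => Nat.add_lt_add_right h K,
    fun k => ?_, ?_, ⟨1, 1, one_pos, le_rfl, ?_⟩, hvisc,
    fun x hx => Metric.infDist_zero_of_mem (hfrontier x hx), hvisc.2.eikonal_of_limitOperator⟩
  · obtain ⟨hvu, hcont, hzero⟩ := hK (k + K) (Nat.le_add_left K k)
    exact ⟨hvu, hcont.continuousOn, fun x hx => hzero x (hfrontier x hx)⟩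
  · exact fun U hU => (tendsto_add_atTop_nat K).eventually
      (hlim.tendstoUniformlyOn (s := closure Ω) U hU)
  · exact holderOnWith_one.2 (Metric.lipschitz_infDist_pt _).lipschitzOnWith
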